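/- Let $T>0$ and let $g:\mathbb R\to\mathbb R$ be a derivator, i.e. a non-decreasing left-continuous function, with $g(0)=0$ and $g$ continuous at $0$. Let $\mu_g$ be its Lebesgue–Stieltjes measure ($\mu_g([c,d))=g(d)-g(c)$), $\Delta^+g(t)=g(t^+)-g(t)$, $D_g=\{t:\Delta^+g(t)>0\}$, and let $C_g$ be the set of points in a neighbourhood of which $g$ is constant. Let $g^C(t)=g(t)-\sum_{s\in[0,t)\cap D_g}\Delta^+g(s)$, $t\in[0,T]$, be the continuous part of $g$, let $\gamma(x)=\min\{t\in[0,T]: g^C(t)=x\}$, $x\in[0,g^C(T)]$, be its pseudo-inverse, and let $\mu$ be the Lebesgue measure. Let $\mathcal{AC}_g([0,T];E)$ be the set of $g$-absolutely continuous functions $f:[0,T]\to E$: for every $\varepsilon>0$ there is $\delta>0$ such that $\sum_i\|f(v_i)-f(u_i)\|<\varepsilon$ for every finite family of pairwise disjoint intervals $(u_i,v_i)\subset[0,T]$ with $\sum_i (g(v_i)-g(u_i))<\delta$. The $g$-derivative is $f'_g(t)=\lim_{s}\frac{f(s)-f(t)}{g(s)-g(t)}$, where $s\to t^+$ if $t\in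 D_g$ or if $t\notin D_g$ is a right endpoint of a component of $C_g$, $s\to t^-$ if $t\notin D_g$ is a left endpoint of a component of $C_g$, and $s\to t$ at the other points $t\notin C_g$; for $t$ in a component $(a_n,b_n)$ of $C_g$ one puts $f'_g(t)=f'_g(b_n)$. For $\beta\in\mathcal L^1_g([0,T);\mathbb C)$, $\exp_g(\beta;0,\cdot)$ denotes the solution $v\in\mathcal{AC}_g([0,T];\mathbb C)$ of $v'_g(t)=\beta(t)v(t)$ for $\mu_g$-a.e. $t\in[0,T)$, $v(0)=1$. For $b\in\mathcal L^1_g([0,T);\mathbb R)$, $(\sin_g(b;0,\cdot),\cos_g(b;0,\cdot))$ denotes the solution $(x,y)\in\mathcal{AC}_g([0,T];\mathbb R^2)$ of $$\begin{pmatrix}x\\y\end{pmatrix}'_g(t)=\begin{pmatrix}0&b(t)\\-b(t)&0\end{pmatrix}\begin{pmatrix}x(t)\\y(t)\end{pmatrix}\ \text{ for }\mu_g\text{-a.e. }t\in[0,T),\qquad x(0)=0,\ y(0)=1.$$ **Proposition.** Let $b\in\mathcal L^1_g([0,T);\mathbb R)$. The above system and the problems for $\beta=ib$ and $\beta=-ib$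 have unique solutions on $[0,T]$, so that $\sin_g(b;0,\cdot)$, $\cos_g(b;0,\cdot)$ and $\exp_g(\pm ib;0,\cdot)$ are well defined, and for every $t\in[0,T]$, $$\sin_g(b;0,t)=\frac{\exp_g(ib;0,t)-\exp_g(-ib;0,t)}{2i},\qquad \cos_g(b;0,t)=\frac{\exp_g(ib;0,t)+\exp_g(-ib;0,t)}{2}.$$ Furthermore, for every $t\in[0,T]$, the (possibly infinite) product and sum in $$P(t)=\prod_{u\in[0,t)\cap D_g}|1+i\,b(u)\Delta^+g(u)|,\qquad S(t)=\sum_{u\in[0,t)\cap D_g}\operatorname{atan}(b(u)\Delta^+g(u)),$$ converge unconditionally, the function $b\circ\gamma$ is Lebesgue integrable on $[0,g^C(t))$, and, with $I(t)=\int_{[0,g^C(t))}(b\circ\gamma)\,d\mu$, $$\sin_g(b;0,t)=P(t)\sin S(t)\cos I(t)+P(t)\cos S(t)\sin I(t),$$ $$\cos_g(b;0,t)=P(t)\cos S(t)\cos I(t)-P(t)\sin S(t)\sin I(t).$$ -/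

import Mathlib

open Set Filter Topology MeasureTheory

/-- A derivator: a non-decreasing, left-continuous function `g : ℝ → ℝ`. -/
structure Derivator where
  toFun : ℝ → ℝ
  mono : Monotone toFun
  leftCts : ∀ t, ContinuousWithinAt toFun (Iic t) t

namespace Derivator

instance : CoeFun Derivator (fun _ => ℝ → ℝ) := ⟨Derivator.toFun⟩

/-- The Lebesgue--Stieltjes measure `μ_g`, for which `[c, d)` has measure `g d - g c`. -/
noncomputable def measure (g : Derivator) : Measure ℝ :=
  g.mono.stieltjesFunction.measure

theorem measure_Ico (g : Derivator) (c d : ℝ) :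
    g.measure (Ico c d) = ENNReal.ofReal (g d - g c) := by
  have key : ∀ x, Function.leftLim g.mono.stieltjesFunction x = g x := by
    intro x
    have h1 : Function.leftLim (Function.rightLim g.toFun) x = Function.leftLim g.toFun x :=
      leftLim_rightLim (g.mono.tendsto_leftLim x)
    have h2 : Function.leftLim g.toFun x = g.toFun x := (g.leftCts x).leftLim_eq
    exact h1.trans h2
  rw [measure, StieltjesFunction.measure_Ico, key, key]

/-- The jump `Δ⁺g(t) = g(t⁺) - g(t)`. -/
noncomputable def jump (g : Derivator) (t : ℝ) : ℝ := Function.rightLim g t - g t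

/-- The set `D_g` of discontinuity points of `g`. -/
def jumpSet (g : Derivator) : Set ℝ := {t | 0 < g.jump t}

/-- The set `C_g` of points around which `g` is constant. -/
def constSet (g : Derivator) : Set ℝ :=
  {t | ∃ ε > 0, ∀ s ∈ Ioo (t - ε) (t + ε), g s = g t}

/-- `N_g⁻`: left endpoints of connected components of `C_g`, except points of `D_g`. -/
def constLeft (g : Derivator) : Set ℝ :=
  {t | t ∉ g.constSet ∧ ∃ s > t, Ioo t s ⊆ g.constSet} \ g.jumpSet

/-- `N_g⁺`: right endpoints of connected components of `C_g`, except points of `D_g`. -/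
def constRight (g : Derivator) : Set ℝ :=
  {t | t ∉ g.constSet ∧ ∃ s < t, Ioo s t ⊆ g.constSet} \ g.jumpSet

/-- The jump part `g^B` of `g`, based at `a`. -/
noncomputable def jumpPart (g : Derivator) (a t : ℝ) : ℝ :=
  if a < t then ∑' s : ↥(Ico a t ∩ g.jumpSet), g.jump s
  else -∑' s : ↥(Ico t a ∩ g.jumpSet), g.jump s

/-- The continuous part `g^C = g - g^B` of `g`, based at `a`. -/
noncomputable def contPart (g : Derivator) (a t : ℝ) : ℝ := g t - g.jumpPart a t

/-- The pseudo-inverse `γ` of the continuous part of `g` in the interval `[a, b]`: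
`γ x = min {t ∈ [a, b] | g^C t = x}`. The minimum is written as an infimum. -/
noncomputable def pseudoInv (g : Derivator) (a b x : ℝ) : ℝ :=
  sInf {t | t ∈ Icc a b ∧ g.contPart a t = x}

/-- The points from which `p` is approached in the `g`-derivative at `p ∉ C_g`: points on the right
if `p ∈ D_g ∪ N_g⁺`, points on the left if `p ∈ N_g⁻`, both otherwise. -/
def approachSet (g : Derivator) (p : ℝ) : Set ℝ :=
  {s | s ≠ p ∧ (p ∈ g.jumpSet ∪ g.constRight → p < s) ∧ (p ∈ g.constLeft → s < p)}

section
variable {E : Type*} [NormedAddCommGroup E] [NormedSpace ℝ E]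

/-- The limit of the `g`-difference quotients of `f : [a, b] → E` at `p` exists
(in particular, `p` can be approached from within `[a, b]`) and is `f'`. -/
def HasQuotientLimit (g : Derivator) (a b : ℝ) (f : ℝ → E) (f' : E) (p : ℝ) : Prop :=
  (𝓝[g.approachSet p ∩ Icc a b] p).NeBot ∧
    Tendsto (fun s => (g s - g p)⁻¹ • (f s - f p)) (𝓝[g.approachSet p ∩ Icc a b] p) (𝓝 f')

/-- `f : [a, b] → E` is `g`-differentiable at `t ∈ [a, b]` with `g`-derivative `f'`. At a point `t`
of a component `(a_n, b_n)` of `C_g`, the quotients are taken at `b_n`. -/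
def HasGDerivAt (g : Derivator) (a b : ℝ) (f : ℝ → E) (f' : E) (t : ℝ) : Prop :=
  t ∈ Icc a b ∧
    ((t ∉ g.constSet ∧ g.HasQuotientLimit a b f f' t) ∨
      (t ∈ g.constSet ∧ ∃ p ∈ Icc a b, t < p ∧ p ∉ g.constSet ∧ Ico t p ⊆ g.constSet ∧
        g.HasQuotientLimit a b f f' p))

/-- `f ∈ AC_g([a, b]; E)`: for every `ε > 0` there is `δ > 0` such that every finite family of
pairwise disjoint open subintervals `(u i, v i)` of `[a, b]` with `∑ (g (v i) - g (u i)) < δ`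
satisfies `∑ ‖f (v i) - f (u i)‖ < ε`. -/
def AbsCont (g : Derivator) (a b : ℝ) (f : ℝ → E) : Prop :=
  ∀ ε > 0, ∃ δ > 0, ∀ (n : ℕ) (u v : Fin n → ℝ),
    (∀ i, a ≤ u i ∧ u i < v i ∧ v i ≤ b) →
    (∀ i j, i ≠ j → Disjoint (Ioo (u i) (v i)) (Ioo (u j) (v j))) →
    ∑ i, (g (v i) - g (u i)) < δ → ∑ i, ‖f (v i) - f (u i)‖ < ε

end

section
variable {𝕜 : Type*} [RCLike 𝕜]

/-- `v ∈ AC_g([0, T]; 𝕜)` solves `v'_g = β v` `g`-a.e. in `[0, T)`, `v 0 = 1`. -/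
def IsExpSolution (g : Derivator) (T : ℝ) (β : ℝ → 𝕜) (v : ℝ → 𝕜) : Prop :=
  g.AbsCont 0 T v ∧
    (∀ᵐ t ∂(g.measure.restrict (Ico 0 T)), g.HasGDerivAt 0 T v (β t * v t) t) ∧
    v 0 = 1

/-- The `g`-exponential `exp_g(β; 0, ·)` on `[0, T]`: the solution of `v'_g = β v`, `v 0 = 1`. -/
noncomputable def gExp (g : Derivator) (T : ℝ) (β : ℝ → 𝕜) : ℝ → 𝕜 :=
  Classical.epsilon (g.IsExpSolution T β)

/-- `X = (x₀, x₁) ∈ AC_g([0, T]; 𝕜²)` solves the system `X'_g = (0, b; -b, 0) X`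
`g`-a.e. in `[0, T)`, `X 0 = (0, 1)`. -/
def IsSinCosSolution (g : Derivator) (T : ℝ) (b : ℝ → 𝕜) (X : ℝ → Fin 2 → 𝕜) : Prop :=
  g.AbsCont 0 T X ∧
    (∀ᵐ t ∂(g.measure.restrict (Ico 0 T)),
      g.HasGDerivAt 0 T X (Matrix.mulVec !![0, b t; -b t, 0] (X t)) t) ∧
    X 0 = ![0, 1]

/-- The solution `(sin_g(b; 0, ·), cos_g(b; 0, ·))` of the system on `[0, T]`. -/
noncomputable def gSinCos (g : Derivator) (T : ℝ) (b : ℝ → 𝕜) : ℝ → Fin 2 → 𝕜 :=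
  Classical.epsilon (g.IsSinCosSolution T b)

/-- The `g`-sine `sin_g(b; 0, t)`. -/
noncomputable def gSin (g : Derivator) (T : ℝ) (b : ℝ → 𝕜) (t : ℝ) : 𝕜 := g.gSinCos T b t 0

/-- The `g`-cosine `cos_g(b; 0, t)`. -/
noncomputable def gCos (g : Derivator) (T : ℝ) (b : ℝ → 𝕜) (t : ℝ) : 𝕜 := g.gSinCos T b t 1

end

end Derivator

/-! Everything is read off from `exp_g(ib; 0, ·)`: the map `(x, y) ↦ y + i x` turns the real system
into `v' = i b v`, so sine and cosine are the imaginary and real parts of the exponential, and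
complex conjugation exchanges the problems for `ib` and `-ib`.

The exponential is `exp L` with `L t = ∫_{[0,t)} ℓ dμ_g`, where `ℓ = β` off the jumps and `ℓ = log
(1 + β Δ⁺g) / Δ⁺g` at them; the logarithm exists since `1 + i x ≠ 0` for real `x`. Existence rests
on a Lebesgue differentiation theorem for `μ_g` (`ae_hasGDerivAt_setIntegral`) and a chain rule that
treats jumps and continuity points at once. Uniqueness follows because `v exp (-L)` has zero
`g`-derivative almost everywhere for every solution `v`, hence is constant
(`AbsCont.eq_of_hasGDerivAt_zero`).

Splitting `L t` over `D_g` and its complement gives the explicit form. Over `D_g` it is a sum of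
`log (1 + i b Δ⁺g)`, whose real and imaginary parts yield the product of moduli and the sum of
arctangents. Off `D_g`, `μ_g` is the image of Lebesgue measure under `γ`, which yields `i ∫ b ∘ γ`.
The formulas are then the addition theorems for sine and cosine. -/

/-- Induction along a compact real interval. -/
theorem real_induction_Icc {a b : ℝ} {P : ℝ → Prop} (ha : P a)
    (hright : ∀ t ∈ Ico a b, (∀ s ∈ Icc a t, P s) → ∀ᶠ s in 𝓝[>] t, s ≤ b → P s)
    (hleft : ∀ t ∈ Ioc a b, (∀ s ∈ Ico a t, P s) → P t) : ∀ t ∈ Icc a b, P t := by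
  intro t₀ ht₀
  have hab : a ≤ b := ht₀.1.trans ht₀.2
  set S : Set ℝ := {t | t ∈ Icc a b ∧ ∀ s ∈ Icc a t, P s} with hS
  have haS : a ∈ S := ⟨⟨le_rfl, hab⟩, fun s hs => by rwa [le_antisymm hs.2 hs.1]⟩
  have hbdd : BddAbove S := ⟨b, fun t ht => ht.1.2⟩
  set c := sSup S
  have hac : a ≤ c := le_csSup hbdd haS
  have hcb : c ≤ b := csSup_le ⟨a, haS⟩ fun t ht => ht.1.2
  have hlt : ∀ s ∈ Ico a c, P s := by
    intro s hs
    obtain ⟨r, hr, hsr⟩ := exists_lt_of_lt_csSup ⟨a, haS⟩ hs.2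
    exact hr.2 s ⟨hs.1, hsr.le⟩
  have hc : P c := by
    rcases hac.eq_or_lt with h | h
    · rwa [← h]
    · exact hleft c ⟨h, hcb⟩ hlt
  have hle : ∀ s ∈ Icc a c, P s := fun s hs => by
    rcases hs.2.eq_or_lt with h | h
    · rwa [h]
    · exact hlt s ⟨hs.1, h⟩
  suffices c = b from hle t₀ ⟨ht₀.1, ht₀.2.trans this.ge⟩
  by_contra hne
  have hcb' : c < b := lt_of_le_of_ne hcb hne
  obtain ⟨u, hu, hP⟩ := mem_nhdsGT_iff_exists_Ioo_subset.1 (hright c ⟨hac, hcb'⟩ hle)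
  obtain ⟨r, hcr, hr⟩ := exists_between (lt_min hu hcb')
  have : r ∈ S := by
    refine ⟨⟨hac.trans hcr.le, (hr.trans_le (min_le_right _ _)).le⟩, fun s hs => ?_⟩
    rcases le_or_gt s c with h | h
    · exact hle s ⟨hs.1, h⟩
    · exact hP ⟨h, hs.2.trans_lt (hr.trans_le (min_le_left _ _))⟩
        (hs.2.trans (hr.trans_le (min_le_right _ _)).le)
  exact hcr.not_ge (le_csSup hbdd this)

/-! ### Jumps, the Stieltjes measure and negligible sets of points. -/

namespace Derivator

theorem leftLim_eq (g : Derivator) (t : ℝ) : Function.leftLim g t = g t :=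
  (g.leftCts t).leftLim_eq

theorem tendsto_nhdsGT (g : Derivator) (t : ℝ) :
    Tendsto g (𝓝[>] t) (𝓝 (g t + g.jump t)) := by
  simpa [jump] using g.mono.tendsto_rightLim t

theorem jump_nonneg (g : Derivator) (t : ℝ) : 0 ≤ g.jump t :=
  sub_nonneg.2 (g.mono.le_rightLim le_rfl)

theorem add_jump_le (g : Derivator) {s t : ℝ} (h : s < t) : g s + g.jump s ≤ g t := by
  simpa [jump] using g.mono.rightLim_le h

theorem jump_eq_zero {g : Derivator} {t : ℝ} (h : t ∉ g.jumpSet) : g.jump t = 0 :=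
  le_antisymm (not_lt.1 h) (g.jump_nonneg t)

theorem continuousAt_of_notMem {g : Derivator} {t : ℝ} (h : t ∉ g.jumpSet) : ContinuousAt g t := by
  rw [continuousAt_iff_continuous_left'_right']
  refine ⟨(g.leftCts t).mono Iio_subset_Iic_self, ?_⟩
  have := g.tendsto_nhdsGT t
  rwa [jump_eq_zero h, add_zero] at this

theorem measure_singleton (g : Derivator) (t : ℝ) :
    g.measure {t} = ENNReal.ofReal (g.jump t) := by
  have h1 : Function.leftLim (Function.rightLim g.toFun) t = Function.leftLim g.toFun t :=
    leftLim_rightLim (g.mono.tendsto_leftLim t)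
  rw [measure, StieltjesFunction.measure_singleton, jump]
  congr 2
  exact h1.trans (g.leftLim_eq t)

instance (g : Derivator) : IsLocallyFiniteMeasure g.measure := by
  unfold measure; infer_instance

theorem measure_Ico_lt_top (g : Derivator) (c d : ℝ) : g.measure (Ico c d) < ⊤ := by
  rw [g.measure_Ico]; exact ENNReal.ofReal_lt_top

theorem countable_jumpSet (g : Derivator) : g.jumpSet.Countable := by
  refine Countable.mono ?_ g.mono.countable_not_continuousAt
  intro t ht hc
  have h1 := tendsto_nhds_unique (g.tendsto_nhdsGT t) (hc.mono_left nhdsWithin_le_nhds)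
  have h2 : 0 < g.jump t := ht
  linarith

theorem measurableSet_jumpSet (g : Derivator) : MeasurableSet g.jumpSet :=
  g.countable_jumpSet.measurableSet

theorem measurable_jump (g : Derivator) : Measurable g.jump :=
  g.mono.rightLim.measurable.sub g.mono.measurable

theorem measure_constSet (g : Derivator) : g.measure g.constSet = 0 := by
  refine measure_null_of_locally_null _ fun t ht => ?_
  obtain ⟨ε, hε, h⟩ := ht
  refine ⟨Ico (t - ε / 2) (t + ε / 2), mem_nhdsWithin_of_mem_nhds
    (Ico_mem_nhds (by linarith) (by linarith)), ?_⟩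
  rw [g.measure_Ico, h (t + ε / 2) ⟨by linarith, by linarith⟩,
    h (t - ε / 2) ⟨by linarith, by linarith⟩]
  simp

/-- Intervals of constancy chosen to the right of distinct points are disjoint, because such a point
is itself outside `C_g`. -/
theorem countable_constLeft (g : Derivator) : g.constLeft.Countable := by
  have h : ∀ t, ∃ s, t ∈ g.constLeft → t < s ∧ Ioo t s ⊆ g.constSet := by
    intro t
    by_cases ht : t ∈ g.constLeft
    · obtain ⟨s, hs⟩ := ht.1.2
      exact ⟨s, fun _ => hs⟩
    · exact ⟨0, fun h => absurd h ht⟩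
  choose y hy using h
  refine PairwiseDisjoint.countable_of_Ioo (y := y) ?_ fun t ht => (hy t ht).1
  have key : ∀ s ∈ g.constLeft, ∀ t ∈ g.constLeft, s < t → Disjoint (Ioo s (y s)) (Ioo t (y t)) := by
    intro s hs t ht hst
    refine disjoint_left.2 fun x hx hx' => ?_
    exact ht.1.1 ((hy s hs).2 ⟨hst, hx'.1.trans hx.2⟩)
  intro s hs t ht hst
  rcases lt_or_gt_of_ne hst with h | h
  · exact key s hs t ht h
  · exact (key t ht s hs h).symm

theorem countable_constRight (g : Derivator) : g.constRight.Countable := by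
  have h : ∀ t, ∃ s, t ∈ g.constRight → s < t ∧ Ioo s t ⊆ g.constSet := by
    intro t
    by_cases ht : t ∈ g.constRight
    · obtain ⟨s, hs⟩ := ht.1.2
      exact ⟨s, fun _ => hs⟩
    · exact ⟨0, fun h => absurd h ht⟩
  choose y hy using h
  have key : ∀ s ∈ g.constRight, ∀ t ∈ g.constRight, s < t →
      Disjoint (Ioo (y s) s) (Ioo (y t) t) := by
    intro s hs t ht hst
    refine disjoint_left.2 fun x hx hx' => ?_
    exact hs.1.1 ((hy t ht).2 ⟨hx'.1.trans hx.2, hst⟩)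
  refine PairwiseDisjoint.countable_of_isOpen (s := fun t => Ioo (y t) t) ?_
    (fun t _ => isOpen_Ioo) fun t ht => nonempty_Ioo.2 (hy t ht).1
  intro s hs t ht hst
  rcases lt_or_gt_of_ne hst with h | h
  · exact key s hs t ht h
  · exact (key t ht s hs h).symm

theorem measure_eq_zero_of_countable {g : Derivator} {s : Set ℝ} (hs : s.Countable)
    (hd : ∀ t ∈ s, t ∉ g.jumpSet) : g.measure s = 0 := by
  rw [← biUnion_of_singleton s, measure_biUnion_null_iff hs]
  intro t ht
  rw [g.measure_singleton, jump_eq_zero (hd t ht), ENNReal.ofReal_zero]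

/-- The points outside `C_g ∪ N_g⁻ ∪ N_g⁺`. -/
def regularSet (g : Derivator) : Set ℝ := {t | t ∉ g.constSet ∧ t ∉ g.constLeft ∧ t ∉ g.constRight}

/-- `C_g` is locally null, and the endpoint sets are countable and avoid the atoms of `μ_g`. All
almost-everywhere arguments below may therefore ignore the special cases of the `g`-derivative. -/
theorem ae_mem_regularSet (g : Derivator) : ∀ᵐ t ∂g.measure, t ∈ g.regularSet := by
  have h1 := measure_eq_zero_iff_ae_notMem.1 g.measure_constSet
  have h2 := measure_eq_zero_iff_ae_notMem.1
    (measure_eq_zero_of_countable g.countable_constLeft fun t ht => ht.2)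
  have h3 := measure_eq_zero_iff_ae_notMem.1
    (measure_eq_zero_of_countable g.countable_constRight fun t ht => ht.2)
  filter_upwards [h1, h2, h3] with t a b c using ⟨a, b, c⟩

theorem Ioo_subset_constSet {g : Derivator} {s t : ℝ} (h : g s = g t) : Ioo s t ⊆ g.constSet := by
  have hc : ∀ r ∈ Icc s t, g r = g s := fun r hr =>
    le_antisymm ((g.mono hr.2).trans h.ge) (g.mono hr.1)
  intro r hr
  refine ⟨min (r - s) (t - r), lt_min (by linarith [hr.1]) (by linarith [hr.2]), fun x hx => ?_⟩
  rw [hc r ⟨hr.1.le, hr.2.le⟩]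
  exact hc x ⟨by linarith [hx.1, min_le_left (r - s) (t - r)],
    by linarith [hx.2, min_le_right (r - s) (t - r)]⟩

/-- Equality would make `g` constant on `(t, s)`, which rules out a jump at `t` and so puts `t` in
`N_g⁻`. -/
theorem lt_of_mem_regularSet {g : Derivator} {t s : ℝ} (ht : t ∈ g.regularSet) (hs : t < s) :
    g t < g s := by
  refine lt_of_le_of_ne (g.mono hs.le) fun h => ht.2.1 ⟨⟨ht.1, s, hs, Ioo_subset_constSet h⟩, ?_⟩
  intro hj
  have := g.add_jump_le hs
  have hj' : 0 < g.jump t := hj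
  linarith

theorem lt_of_mem_regularSet_left {g : Derivator} {t s : ℝ} (ht : t ∈ g.regularSet)
    (hj : t ∉ g.jumpSet) (hs : s < t) : g s < g t :=
  lt_of_le_of_ne (g.mono hs.le) fun h => ht.2.2 ⟨⟨ht.1, s, hs, Ioo_subset_constSet h⟩, hj⟩

theorem approachSet_of_mem_jumpSet {g : Derivator} {t : ℝ} (hj : t ∈ g.jumpSet) :
    g.approachSet t = Ioi t := by
  ext s
  simp only [approachSet, mem_ofPred_eq, mem_union, hj, true_or, true_imp_iff, mem_Ioi]
  exact ⟨fun h => h.2.1, fun h => ⟨h.ne', h, fun h' => absurd hj h'.2⟩⟩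

theorem approachSet_of_notMem_jumpSet {g : Derivator} {t : ℝ} (ht : t ∈ g.regularSet)
    (hj : t ∉ g.jumpSet) : g.approachSet t = {t}ᶜ := by
  ext s
  simp [approachSet, hj, ht.2.1, ht.2.2]

/-! ### The `g`-derivative at regular points. -/

/-- The filter along which the difference quotients at a regular point are taken. -/
def approachFilter (g : Derivator) (T t : ℝ) : Filter ℝ := 𝓝[g.approachSet t ∩ Icc 0 T] t

theorem nhdsGT_le_approachFilter {g : Derivator} {T t : ℝ} (ht : t ∈ g.regularSet)
    (h : t ∈ Ico 0 T) : 𝓝[>] t ≤ g.approachFilter T t := by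
  rw [approachFilter]
  refine (nhdsWithin_Ioc_eq_nhdsGT h.2).symm.le.trans (nhdsWithin_mono t ?_)
  refine subset_inter ?_ fun s hs => ⟨h.1.trans hs.1.le, hs.2⟩
  by_cases hj : t ∈ g.jumpSet
  · rw [approachSet_of_mem_jumpSet hj]
    exact fun s hs => hs.1
  · rw [approachSet_of_notMem_jumpSet ht hj]
    exact fun s hs => hs.1.ne'

theorem approachFilter_neBot {g : Derivator} {T t : ℝ} (ht : t ∈ g.regularSet)
    (h : t ∈ Ico 0 T) : (g.approachFilter T t).NeBot :=
  NeBot.mono inferInstance (nhdsGT_le_approachFilter ht h)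

theorem tendsto_approachFilter (g : Derivator) (T t : ℝ) :
    Tendsto g (g.approachFilter T t) (𝓝 (g t + g.jump t)) := by
  by_cases hj : t ∈ g.jumpSet
  · refine (g.tendsto_nhdsGT t).mono_left ?_
    rw [approachFilter, approachSet_of_mem_jumpSet hj]
    exact nhdsWithin_mono t inter_subset_left
  · rw [jump_eq_zero hj, add_zero]
    exact (continuousAt_of_notMem hj).tendsto.mono_left nhdsWithin_le_nhds

theorem eventually_ne_approachFilter {g : Derivator} {T t : ℝ} (ht : t ∈ g.regularSet) :
    ∀ᶠ s in g.approachFilter T t, g s - g t ≠ 0 := by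
  refine eventually_nhdsWithin_of_forall fun s hs => ?_
  by_cases hj : t ∈ g.jumpSet
  · rw [approachSet_of_mem_jumpSet hj] at hs
    exact (sub_pos.2 (lt_of_mem_regularSet ht hs.1)).ne'
  · rcases lt_or_gt_of_ne hs.1.1 with h | h
    · exact (sub_neg.2 (lt_of_mem_regularSet_left ht hj h)).ne
    · exact (sub_pos.2 (lt_of_mem_regularSet ht h)).ne'

variable {E : Type*} [NormedAddCommGroup E] [NormedSpace ℝ E]

theorem hasGDerivAt_iff {g : Derivator} {T t : ℝ} {f : ℝ → E} {f' : E} (ht : t ∈ g.regularSet)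
    (h : t ∈ Ico 0 T) : g.HasGDerivAt 0 T f f' t ↔
      Tendsto (fun s => (g s - g t)⁻¹ • (f s - f t)) (g.approachFilter T t) (𝓝 f') := by
  have := approachFilter_neBot ht h
  simp only [HasGDerivAt, ht.1, not_false_eq_true, true_and, false_and, or_false, HasQuotientLimit]
  exact ⟨fun H => H.2.2, fun H => ⟨⟨h.1, h.2.le⟩, this, H⟩⟩

/-- Multiplying the quotient by `g s - g t → Δ⁺g(t)` recovers the limit of `f`; this supplies the
jump terms in the product and chain rules. -/
theorem tendsto_of_quotient {g : Derivator} {T t : ℝ} {f : ℝ → E} {f' : E} (ht : t ∈ g.regularSet)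
    (hf : Tendsto (fun s => (g s - g t)⁻¹ • (f s - f t)) (g.approachFilter T t) (𝓝 f')) :
    Tendsto f (g.approachFilter T t) (𝓝 (f t + g.jump t • f')) := by
  have h1 := ((g.tendsto_approachFilter T t).sub_const (g t)).smul hf
  rw [add_sub_cancel_left] at h1
  refine (h1.const_add (f t)).congr' ?_
  filter_upwards [eventually_ne_approachFilter ht] with s hs
  rw [smul_inv_smul₀ hs, add_sub_cancel]

/-! ### `g`-absolutely continuous functions. -/

variable {E : Type*} [NormedAddCommGroup E]

theorem AbsCont.norm_sub_lt {g : Derivator} {a b : ℝ} {f : ℝ → E} (hf : g.AbsCont a b f) {ε : ℝ}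
    (hε : 0 < ε) : ∃ δ > 0, ∀ u v, a ≤ u → u ≤ v → v ≤ b → g v - g u < δ → ‖f v - f u‖ < ε := by
  obtain ⟨δ, hδ, h⟩ := hf ε hε
  refine ⟨δ, hδ, fun u v hu huv hv hg => ?_⟩
  rcases huv.eq_or_lt with rfl | huv
  · simpa using hε
  · simpa using h 1 (fun _ => u) (fun _ => v) (fun _ => ⟨hu, huv, hv⟩)
      (fun i j hij => absurd (Subsingleton.elim i j) hij) (by simpa using hg)

/-- Domination by two functions is the form needed for products; taking both equal covers Lipschitz
images. -/
theorem AbsCont.of_norm_le {F G : Type*} [NormedAddCommGroup F]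
    [NormedAddCommGroup G] {g : Derivator} {a b : ℝ} {f : ℝ → E} {k : ℝ → F}
    {h : ℝ → G} (hf : g.AbsCont a b f) (hk : g.AbsCont a b k) {C : ℝ} (hC : 0 < C)
    (hle : ∀ u v, a ≤ u → u < v → v ≤ b → ‖h v - h u‖ ≤ C * (‖f v - f u‖ + ‖k v - k u‖)) :
    g.AbsCont a b h := by
  intro ε hε
  obtain ⟨δ₁, hδ₁, h₁⟩ := hf (ε / (2 * C)) (by positivity)
  obtain ⟨δ₂, hδ₂, h₂⟩ := hk (ε / (2 * C)) (by positivity)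
  refine ⟨min δ₁ δ₂, lt_min hδ₁ hδ₂, fun n u v huv hd hs => ?_⟩
  have H₁ := h₁ n u v huv hd (hs.trans_le (min_le_left _ _))
  have H₂ := h₂ n u v huv hd (hs.trans_le (min_le_right _ _))
  calc ∑ i, ‖h (v i) - h (u i)‖
      ≤ ∑ i, C * (‖f (v i) - f (u i)‖ + ‖k (v i) - k (u i)‖) :=
        Finset.sum_le_sum fun i _ => hle _ _ (huv i).1 (huv i).2.1 (huv i).2.2
    _ = C * (∑ i, ‖f (v i) - f (u i)‖ + ∑ i, ‖k (v i) - k (u i)‖) := by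
        rw [← Finset.mul_sum, Finset.sum_add_distrib]
    _ < C * (ε / (2 * C) + ε / (2 * C)) := by gcongr
    _ = ε := by field_simp; ring

theorem AbsCont.clm_comp [NormedSpace ℝ E] {F : Type*} [NormedAddCommGroup F]
    [NormedSpace ℝ F] {g : Derivator} {a b : ℝ} {f : ℝ → E} (hf : g.AbsCont a b f) (A : E →L[ℝ] F) :
    g.AbsCont a b fun t => A (f t) := by
  -- The summand `1` keeps the constant positive when `A = 0`.
  refine hf.of_norm_le hf (C := ‖A‖ + 1) (by positivity) fun u v _ _ _ => ?_
  rw [← map_sub]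
  have h1 := A.le_opNorm (f v - f u)
  nlinarith [norm_nonneg (f v - f u), norm_nonneg A]

theorem HasGDerivAt.clm_comp [NormedSpace ℝ E] {F : Type*} [NormedAddCommGroup F]
    [NormedSpace ℝ F] {g : Derivator} {a b t : ℝ} {f : ℝ → E} {f' : E} (hf : g.HasGDerivAt a b f f' t) (A : E →L[ℝ] F) :
    g.HasGDerivAt a b (fun s => A (f s)) (A f') t := by
  have key : ∀ p, g.HasQuotientLimit a b f f' p →
      g.HasQuotientLimit a b (fun s => A (f s)) (A f') p := by
    intro p hp
    refine ⟨hp.1, ((A.continuous.tendsto f').comp hp.2).congr fun s => ?_⟩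
    simp
  refine ⟨hf.1, hf.2.imp (fun h => ⟨h.1, key _ h.2⟩) fun h => ⟨h.1, ?_⟩⟩
  obtain ⟨p, h1, h2, h3, h4, h5⟩ := h.2
  exact ⟨p, h1, h2, h3, h4, key _ h5⟩

theorem AbsCont.continuousWithinAt_Iio {g : Derivator} {a b : ℝ} {f : ℝ → E}
    (hf : g.AbsCont a b f) {t : ℝ} (ht : t ∈ Ioc a b) : Tendsto f (𝓝[<] t) (𝓝 (f t)) := by
  rw [Metric.tendsto_nhds]
  intro ε hε
  obtain ⟨δ, hδ, h⟩ := hf.norm_sub_lt hε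
  have h1 : Tendsto g (𝓝[<] t) (𝓝 (g t)) := (g.leftCts t).mono Iio_subset_Iic_self
  have h2 : ∀ᶠ s in 𝓝[<] t, g t - δ < g s := h1.eventually (lt_mem_nhds (by linarith))
  filter_upwards [h2, Ioo_mem_nhdsLT ht.1] with s hs hs'
  rw [dist_comm, dist_eq_norm]
  exact h s t hs'.1.le hs'.2.le ht.2 (by linarith)

/-- By compactness a local bound suffices. Since `f` may jump at `t`, points on the left are
compared with `t`, while points on the right, where `g` is within `δ` of `g(t⁺)`, are compared with
one fixed point `q > t`. -/
theorem AbsCont.exists_norm_le {g : Derivator} {a b : ℝ} {f : ℝ → E} (hf : g.AbsCont a b f) :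
    ∃ C > 0, ∀ t ∈ Icc a b, ‖f t‖ ≤ C := by
  obtain ⟨δ, hδ, h⟩ := hf.norm_sub_lt one_pos
  suffices ∃ C, ∀ t ∈ Icc a b, ‖f t‖ ≤ C by
    obtain ⟨C, hC⟩ := this
    exact ⟨max C 1, by positivity, fun t ht => (hC t ht).trans (le_max_left _ _)⟩
  refine isCompact_Icc.induction_on (p := fun s => ∃ C, ∀ t ∈ s, ‖f t‖ ≤ C) ⟨0, by simp⟩
    (fun s t hst ⟨C, hC⟩ => ⟨C, fun x hx => hC x (hst hx)⟩) ?_ fun t ht => ?_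
  · rintro s t ⟨C, hC⟩ ⟨D, hD⟩
    refine ⟨max C D, fun x hx => ?_⟩
    rcases hx with hx | hx
    · exact (hC x hx).trans (le_max_left _ _)
    · exact (hD x hx).trans (le_max_right _ _)
  · have h1 : ∀ᶠ s in 𝓝[≤] t, g t - δ < g s := (g.leftCts t).eventually (lt_mem_nhds (by linarith))
    have h2 : ∀ᶠ s in 𝓝[>] t, g s < g t + g.jump t + δ :=
      (g.tendsto_nhdsGT t).eventually (gt_mem_nhds (by linarith))
    obtain ⟨l, hl, hl'⟩ := mem_nhdsLE_iff_exists_Ioc_subset.1 h1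
    obtain ⟨r, hr, hr'⟩ := mem_nhdsGT_iff_exists_Ioo_subset.1 h2
    refine ⟨Icc a b ∩ Ioo l r, inter_mem_nhdsWithin _ (Ioo_mem_nhds hl hr), ?_⟩
    by_cases hq : ∃ q, q ∈ Ioo t r ∧ q ≤ b
    · obtain ⟨q, hq, hqb⟩ := hq
      refine ⟨max (‖f t‖ + 1) (‖f q‖ + 1), fun x hx => ?_⟩
      rcases le_or_gt x t with hxt | hxt
      · refine le_trans ?_ (le_max_left _ _)
        have h3 := hl' ⟨hx.2.1, hxt⟩
        have h4 := h x t hx.1.1 hxt ht.2 (by simp at h3; linarith)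
        have := norm_sub_norm_le (f x) (f t)
        rw [norm_sub_rev] at this
        linarith
      · refine le_trans ?_ (le_max_right _ _)
        have h3 : g x < _ := hr' ⟨hxt, hx.2.2⟩
        have h4 : g q < _ := hr' hq
        have h5 := g.add_jump_le hxt
        have h6 := g.add_jump_le hq.1
        have h7 : ‖f x - f q‖ < 1 := by
          rcases le_total x q with h' | h'
          · rw [norm_sub_rev]
            exact h x q hx.1.1 h' hqb (by linarith)
          · exact h q x (ht.1.trans hq.1.le) h' hx.1.2 (by linarith)
        have := norm_sub_norm_le (f x) (f q)
        linarith
    · refine ⟨‖f t‖ + 1, fun x hx => ?_⟩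
      have hxt : x ≤ t := by
        by_contra hxt
        exact hq ⟨x, ⟨not_le.1 hxt, hx.2.2⟩, hx.1.2⟩
      have h3 := hl' ⟨hx.2.1, hxt⟩
      have h4 := h x t hx.1.1 hxt ht.2 (by simp at h3; linarith)
      have := norm_sub_norm_le (f x) (f t)
      rw [norm_sub_rev] at this
      linarith

/-! ### Functions with vanishing `g`-derivative. -/

theorem disjoint_Ico_of_disjoint_Ioo {u v u' v' : ℝ} (hd : Disjoint (Ioo u v) (Ioo u' v')) :
    Disjoint (Ico u v) (Ico u' v') := by
  rw [Ioo_disjoint_Ioo] at hd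
  rwa [Ico_disjoint_Ico]

theorem sum_increments_le {g : Derivator} {U : Set ℝ} {n : ℕ} {u v : Fin n → ℝ}
    (huv : ∀ i, u i < v i) (hU : ∀ i, Ico (u i) (v i) ⊆ U)
    (hd : ∀ i j, i ≠ j → Disjoint (Ioo (u i) (v i)) (Ioo (u j) (v j))) :
    ENNReal.ofReal (∑ i, (g (v i) - g (u i))) ≤ g.measure U := by
  rw [ENNReal.ofReal_sum_of_nonneg fun i _ => sub_nonneg.2 (g.mono (huv i).le)]
  simp_rw [← g.measure_Ico]
  have h := measure_iUnion (μ := g.measure)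
    (fun i j hij => disjoint_Ico_of_disjoint_Ioo (hd i j hij))
    fun i : Fin n => measurableSet_Ico (a := u i) (b := v i)
  rw [tsum_fintype] at h
  rw [← h]
  exact measure_mono (iUnion_subset hU)

/-- The sums of increments of `f` over finite disjoint families of intervals in `U ∩ [0, t]`. -/
def incrementSums (f : ℝ → E) (U : Set ℝ) (t : ℝ) : Set ℝ :=
  {x | ∃ (n : ℕ) (u v : Fin n → ℝ),
    (∀ i, 0 ≤ u i ∧ u i < v i ∧ v i ≤ t ∧ Ico (u i) (v i) ⊆ U) ∧
    (∀ i j, i ≠ j → Disjoint (Ioo (u i) (v i)) (Ioo (u j) (v j))) ∧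
    x = ∑ i, ‖f (v i) - f (u i)‖}

theorem zero_mem_incrementSums (f : ℝ → E) (U : Set ℝ) (t : ℝ) : 0 ∈ incrementSums f U t :=
  ⟨0, fun i => 0, fun i => 0, fun i => i.elim0, fun i => i.elim0, by simp⟩

theorem incrementSums_mono (f : ℝ → E) (U : Set ℝ) {s t : ℝ} (h : s ≤ t) :
    incrementSums f U s ⊆ incrementSums f U t := by
  rintro x ⟨n, u, v, h1, h2, h3⟩
  exact ⟨n, u, v, fun i => ⟨(h1 i).1, (h1 i).2.1, (h1 i).2.2.1.trans h, (h1 i).2.2.2⟩, h2, h3⟩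

/-- Adjoining one more interval to a family makes the supremum of the sums superadditive in the
endpoint. -/
theorem add_mem_incrementSums {f : ℝ → E} {U : Set ℝ} {s t x : ℝ} (h0 : 0 ≤ s) (h : s < t)
    (hU : Ico s t ⊆ U) (hx : x ∈ incrementSums f U s) :
    ‖f t - f s‖ + x ∈ incrementSums f U t := by
  obtain ⟨n, u, v, h1, h2, rfl⟩ := hx
  have hds : ∀ i, Disjoint (Ioo s t) (Ioo (u i) (v i)) := fun i =>
    disjoint_left.2 fun y hy hy' => absurd (hy'.2.trans_le (h1 i).2.2.1) hy.1.not_gt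
  refine ⟨n + 1, Fin.cons s u, Fin.cons t v, ?_, ?_, ?_⟩
  · refine Fin.cases ⟨h0, h, le_rfl, hU⟩ fun i => ?_
    simp only [Fin.cons_succ]
    exact ⟨(h1 i).1, (h1 i).2.1, (h1 i).2.2.1.trans h.le, (h1 i).2.2.2⟩
  · refine Fin.cases (Fin.cases (fun h => absurd rfl h) fun j _ => ?_) fun i =>
      Fin.cases (fun _ => ?_) fun j hij => ?_
    · simpa using hds j
    · simpa using (hds i).symm
    · simpa using h2 i j fun h => hij (by rw [h])
  · rw [Fin.sum_univ_succ]
    simp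

/-- A `g`-absolutely continuous function whose `g`-derivative vanishes almost everywhere is
constant. -/
theorem AbsCont.eq_of_hasGDerivAt_zero [NormedSpace ℝ E] {g : Derivator} {T : ℝ}
    {w : ℝ → E} (hw : g.AbsCont 0 T w)
    (hd : ∀ᵐ t ∂(g.measure.restrict (Ico 0 T)), g.HasGDerivAt 0 T w 0 t) :
    ∀ t ∈ Icc 0 T, w t = w 0 := by
  have main : ∀ ε > 0, ∀ t ∈ Icc 0 T, ‖w t - w 0‖ ≤ ε * (g t - g 0) + ε := by
    intro ε hε
    obtain ⟨δ, hδ, hAC⟩ := hw ε hε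
    set B : Set ℝ := {t | ¬ (t ∈ Ico 0 T → t ∈ g.regularSet ∧ g.HasGDerivAt 0 T w 0 t)}
    have hB : g.measure B = 0 := by
      rw [ae_restrict_iff' measurableSet_Ico] at hd
      have : ∀ᵐ t ∂g.measure, t ∈ Ico 0 T → t ∈ g.regularSet ∧ g.HasGDerivAt 0 T w 0 t := by
        filter_upwards [hd, g.ae_mem_regularSet] with t h1 h2 h3 using ⟨h2, h1 h3⟩
      exact this
    -- Outer regularity covers the exceptional null set by an open `U` of measure below `δ`, so the
    -- total variation of `w` inside `U` is at most `ε`.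
    obtain ⟨U, hBU, hUo, hU⟩ := B.exists_isOpen_lt_of_lt (μ := g.measure) (ENNReal.ofReal δ)
      (by rw [hB]; exact ENNReal.ofReal_pos.2 hδ)
    have hbound : ∀ t ≤ T, ∀ x ∈ incrementSums w U t, x ≤ ε := by
      rintro t ht x ⟨n, u, v, h1, h2, rfl⟩
      refine (hAC n u v (fun i => ⟨(h1 i).1, (h1 i).2.1, (h1 i).2.2.1.trans ht⟩) h2 ?_).le
      exact (ENNReal.ofReal_lt_ofReal_iff hδ).1
        ((sum_increments_le (fun i => (h1 i).2.1) (fun i => (h1 i).2.2.2) h2).trans_lt hU)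
    have hbdd : ∀ t ≤ T, BddAbove (incrementSums w U t) := fun t ht => ⟨ε, hbound t ht⟩
    -- `V` is the variation of `w` spent inside `U` up to `t`; it pays for the exceptional points,
    -- and `ε (g t - g 0)` for the others.
    set V : ℝ → ℝ := fun t => sSup (incrementSums w U t)
    have hVmono : ∀ s t, s ≤ t → t ≤ T → V s ≤ V t := fun s t hst ht =>
      csSup_le_csSup (hbdd t ht) ⟨0, zero_mem_incrementSums w U s⟩ (incrementSums_mono w U hst)
    have hVε : ∀ t ≤ T, V t ≤ ε := fun t ht =>
      csSup_le ⟨0, zero_mem_incrementSums w U t⟩ (hbound t ht)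
    have hVnn : ∀ t ≤ T, 0 ≤ V t := fun t ht => le_csSup (hbdd t ht) (zero_mem_incrementSums w U t)
    have hVadd : ∀ s t, 0 ≤ s → s < t → t ≤ T → Ico s t ⊆ U → ‖w t - w s‖ + V s ≤ V t := by
      intro s t hs hst ht hsub
      rw [← le_sub_iff_add_le']
      refine csSup_le ⟨0, zero_mem_incrementSums w U s⟩ fun x hx => ?_
      rw [le_sub_iff_add_le']
      exact le_csSup (hbdd t ht) (add_mem_incrementSums hs hst hsub hx)
    have claim : ∀ t ∈ Icc 0 T, ‖w t - w 0‖ ≤ ε * (g t - g 0) + V t := by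
      intro t ht
      refine real_induction_Icc (P := fun t => ‖w t - w 0‖ ≤ ε * (g t - g 0) + V t) ?_ ?_ ?_ t ht
      · simpa using hVnn 0 (ht.1.trans ht.2)
      · intro t ht hP
        have hPt := hP t ⟨ht.1, le_rfl⟩
        by_cases hB : t ∈ B
        -- An exceptional point has a right neighbourhood inside `U`, where `V` absorbs the
        -- increment of `w`.
        · obtain ⟨l, r, hlr, hsub⟩ := mem_nhds_iff_exists_Ioo_subset.1 (hUo.mem_nhds (hBU hB))
          filter_upwards [Ioo_mem_nhdsGT hlr.2] with s hs hsT
          have h1 := hVadd t s ht.1 hs.1 hsT fun x hx =>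
            hsub ⟨hlr.1.trans_le hx.1, hx.2.trans hs.2⟩
          have h2 := norm_sub_le_norm_sub_add_norm_sub (w s) (w t) (w 0)
          have h3 := mul_le_mul_of_nonneg_left (g.mono hs.1.le) hε.le
          linarith
        -- The zero derivative bounds the increment of `w` to the right by `ε (g s - g t)`; at a
        -- jump this includes the jump of `w`.
        · obtain ⟨hreg, hder⟩ := not_not.1 hB ht
          have h1 := ((hasGDerivAt_iff hreg ht).1 hder).mono_left (nhdsGT_le_approachFilter hreg ht)
          have h2 := (tendsto_zero_iff_norm_tendsto_zero.1 h1).eventually (gt_mem_nhds hε)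
          filter_upwards [h2, self_mem_nhdsWithin] with s hs hst hsT
          have hlt := sub_pos.2 (lt_of_mem_regularSet hreg hst)
          rw [norm_smul, norm_inv, Real.norm_of_nonneg hlt.le, inv_mul_lt_iff₀ hlt] at hs
          have h2 := norm_sub_le_norm_sub_add_norm_sub (w s) (w t) (w 0)
          have h3 := hVmono t s (le_of_lt hst) hsT
          linarith
      -- The bound passes to the left endpoint by left-continuity of `w` and monotonicity of its
      -- right-hand side.
      · intro t ht hP
        have h1 := ((hw.continuousWithinAt_Iio ht).sub_const (w 0)).norm
        refine le_of_tendsto h1 ?_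
        filter_upwards [Ioo_mem_nhdsLT ht.1] with s hs
        have h2 := hP s ⟨hs.1.le, hs.2⟩
        have h3 := mul_le_mul_of_nonneg_left (g.mono hs.2.le) hε.le
        have h4 := hVmono s t hs.2.le ht.2
        linarith
    exact fun t ht => (claim t ht).trans (by linarith [hVε t ht.2])
  intro t ht
  rw [← sub_eq_zero, ← norm_le_zero_iff]
  have hlim : Tendsto (fun ε : ℝ => ε * (g t - g 0) + ε) (𝓝[>] 0) (𝓝 0) := by
    have : Tendsto (fun ε : ℝ => ε * (g t - g 0) + ε) (𝓝 0) (𝓝 (0 * (g t - g 0) + 0)) :=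
      (tendsto_id.mul_const _).add tendsto_id
    simpa using this.mono_left nhdsWithin_le_nhds
  exact ge_of_tendsto hlim (eventually_nhdsWithin_of_forall fun ε hε => main ε hε t ht)

end Derivator

/-! ### Generalized inverses and images of Lebesgue measure. -/

/-- `γ` is a generalized inverse on `[0, G T)` of the function `G` on `[0, T]`. -/
structure IsGenInverse (T : ℝ) (G γ : ℝ → ℝ) : Prop where
  mem_Icc : ∀ y ∈ Ico 0 (G T), γ y ∈ Icc 0 T
  lt_of_lt : ∀ y ∈ Ico 0 (G T), ∀ s ∈ Icc 0 T, y < G s → γ y < s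
  le_of_lt : ∀ y ∈ Ico 0 (G T), ∀ s ∈ Icc 0 T, γ y < s → y ≤ G s

namespace IsGenInverse

variable {T : ℝ} {G γ : ℝ → ℝ}

theorem monotoneOn (h : IsGenInverse T G γ) : MonotoneOn γ (Ico 0 (G T)) := by
  intro y hy y' hy' hle
  rcases hle.eq_or_lt with rfl | hlt
  · exact le_rfl
  by_contra hc
  have h1 := h.le_of_lt y' hy' (γ y) (h.mem_Icc y hy) (not_le.1 hc)
  exact (h.lt_of_lt y hy (γ y) (h.mem_Icc y hy) (hlt.trans_le h1)).false

theorem aemeasurable (h : IsGenInverse T G γ) {c : ℝ} (hc : c ≤ G T) :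
    AEMeasurable γ (volume.restrict (Ico 0 c)) :=
  aemeasurable_restrict_of_monotoneOn measurableSet_Ico
    (h.monotoneOn.mono (Ico_subset_Ico_right hc))

theorem map_eq (h : IsGenInverse T G γ) (hG0 : G 0 = 0) (hG : MonotoneOn G (Icc 0 T))
    {ν : Measure ℝ} (hν : ∀ a b, 0 ≤ a → a ≤ b → b ≤ T → ν (Ico a b) = ENNReal.ofReal (G b - G a))
    {t : ℝ} (ht : t ∈ Icc 0 T) :
    Measure.map γ (volume.restrict (Ico 0 (G t))) = ν.restrict (Ico 0 t) := by
  have hT : T ∈ Icc 0 T := ⟨ht.1.trans ht.2, le_rfl⟩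
  have h0 : (0 : ℝ) ∈ Icc 0 T := ⟨le_rfl, hT.1⟩
  have hGt : G t ≤ G T := hG ht hT ht.2
  have hsub : ∀ y ∈ Ico 0 (G t), y ∈ Ico 0 (G T) := fun y hy => ⟨hy.1, hy.2.trans_le hGt⟩
  have hm := h.aemeasurable hGt
  have : IsFiniteMeasure (ν.restrict (Ico 0 t)) :=
    ⟨by rw [Measure.restrict_apply_univ, hν 0 t le_rfl ht.1 ht.2]; exact ENNReal.ofReal_lt_top⟩
  have : IsFiniteMeasure (Measure.map γ (volume.restrict (Ico 0 (G t)))) := inferInstance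
  -- Finite measures are compared on half-lines. In the main case the preimage lies between `(G a, G
  -- t)` and `[G a, G t)`, so the choice made by `γ` at the single value `G a` is immaterial.
  refine Measure.ext_of_Ici _ _ fun a => ?_
  rw [Measure.map_apply_of_aemeasurable hm measurableSet_Ici,
    Measure.restrict_apply' measurableSet_Ico, Measure.restrict_apply' measurableSet_Ico]
  rcases lt_or_ge a 0 with ha | ha
  · have e1 : γ ⁻¹' Ici a ∩ Ico 0 (G t) = Ico 0 (G t) := inter_eq_right.2 fun y hy =>
      ha.le.trans (h.mem_Icc y (hsub y hy)).1
    have e2 : Ici a ∩ Ico 0 t = Ico 0 t := inter_eq_right.2 fun y hy => ha.le.trans hy.1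
    rw [e1, e2, hν 0 t le_rfl ht.1 ht.2, hG0, Real.volume_Ico]
  rcases lt_or_ge t a with hat | hat
  · have e1 : γ ⁻¹' Ici a ∩ Ico 0 (G t) = ∅ := eq_empty_of_forall_notMem fun y hy =>
      ((h.lt_of_lt y (hsub y hy.2) t ht hy.2.2).trans hat).not_ge hy.1
    have e2 : Ici a ∩ Ico 0 t = ∅ := eq_empty_of_forall_notMem fun y hy =>
      (hy.2.2.trans hat).not_ge hy.1
    rw [e1, e2, measure_empty, measure_empty]
  · have haT : a ∈ Icc 0 T := ⟨ha, hat.trans ht.2⟩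
    have e2 : Ici a ∩ Ico 0 t = Ico a t := by
      ext y
      exact ⟨fun hy => ⟨hy.1, hy.2.2⟩, fun hy => ⟨hy.1, ha.trans hy.1, hy.2⟩⟩
    have hGa : 0 ≤ G a := hG0 ▸ hG h0 haT ha
    rw [e2, hν a t ha hat ht.2]
    refine le_antisymm ?_ ?_
    · rw [← Real.volume_Ico]
      refine measure_mono fun y hy => ⟨?_, hy.2.2⟩
      by_contra hc
      exact (h.lt_of_lt y (hsub y hy.2) a haT (not_le.1 hc)).not_ge hy.1
    · rw [← Real.volume_Ioo]
      refine measure_mono fun y hy => ?_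
      have hy' : y ∈ Ico 0 (G t) := ⟨hGa.trans hy.1.le, hy.2⟩
      refine ⟨?_, hy'⟩
      by_contra hc
      exact (h.le_of_lt y (hsub y hy') a haT (not_le.1 hc)).not_gt hy.1

end IsGenInverse

/-! ### Lebesgue differentiation with respect to `μ_g`. -/

namespace Derivator

/-- The right-continuous generalized inverse of `g` on `[0, T]`. -/
noncomputable def rightInv (g : Derivator) (T y : ℝ) : ℝ := sSup {t | t ∈ Icc 0 T ∧ g t ≤ y}

section rightInv
variable {g : Derivator} {T y : ℝ}

/-- Left-continuity of `g` makes the supremum attained. -/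
theorem rightInv_mem (hT : 0 ≤ T) (hg0 : g 0 = 0) (hy : 0 ≤ y) :
    g.rightInv T y ∈ Icc 0 T ∧ g (g.rightInv T y) ≤ y := by
  have hbdd : BddAbove {t | t ∈ Icc 0 T ∧ g t ≤ y} := ⟨T, fun t ht => ht.1.2⟩
  have h0 : (0 : ℝ) ∈ {t | t ∈ Icc 0 T ∧ g t ≤ y} := ⟨⟨le_rfl, hT⟩, hg0.trans_le hy⟩
  refine ⟨⟨le_csSup hbdd h0, csSup_le ⟨0, h0⟩ fun t ht => ht.1.2⟩, ?_⟩
  by_contra hc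
  have h1 : ∀ᶠ s in 𝓝[≤] (g.rightInv T y), y < g s :=
    (g.leftCts _).eventually (lt_mem_nhds (not_le.1 hc))
  obtain ⟨l, hl, hl'⟩ := mem_nhdsLE_iff_exists_Ioc_subset.1 h1
  obtain ⟨s, hs, hls⟩ := exists_lt_of_lt_csSup ⟨0, h0⟩ hl
  exact hs.2.not_gt (hl' ⟨hls, le_csSup hbdd hs⟩)

theorem le_rightInv {s : ℝ} (hs : s ∈ Icc 0 T) (h : g s ≤ y) : s ≤ g.rightInv T y :=
  le_csSup ⟨T, fun _ ht => ht.1.2⟩ ⟨hs, h⟩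

theorem isGenInverse_rightInv (hT : 0 ≤ T) (hg0 : g 0 = 0) :
    IsGenInverse T g (g.rightInv T) where
  mem_Icc y hy := (rightInv_mem hT hg0 hy.1).1
  lt_of_lt y hy s _ h := by
    by_contra hc
    exact ((g.mono (not_lt.1 hc)).trans (rightInv_mem hT hg0 hy.1).2).not_gt h
  le_of_lt y hy s hs h := by
    by_contra hc
    exact (le_rightInv hs (not_le.1 hc).le).not_gt h

theorem rightInv_eq {t : ℝ} (hT : 0 ≤ T) (hg0 : g 0 = 0) (ht : t ∈ Icc 0 T) (hy : g t ≤ y)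
    (h : ∀ s, t < s → y < g s) : g.rightInv T y = t := by
  have hy0 : 0 ≤ y := by rw [← hg0]; exact (g.mono ht.1).trans hy
  refine le_antisymm ?_ (le_rightInv ht hy)
  by_contra hc
  exact (h _ (not_le.1 hc)).not_ge (rightInv_mem hT hg0 hy0).2

theorem lt_of_rightInv_lt {s : ℝ} (hT : 0 ≤ T) (hg0 : g 0 = 0) (hy : y ∈ Ico 0 (g T))
    (h : g.rightInv T y < s) : y < g s := by
  rcases le_or_gt s T with hs | hs
  · by_contra hc
    exact (le_rightInv ⟨(rightInv_mem hT hg0 hy.1).1.1.trans h.le, hs⟩ (not_lt.1 hc)).not_gt h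
  · exact hy.2.trans_le (g.mono hs.le)

end rightInv

variable {E : Type*} [NormedAddCommGroup E] [NormedSpace ℝ E]

/-- The increments of `g` add up to the measure of the union of the half-open intervals, and the
integral of `‖f‖` is small over sets of small measure. -/
theorem absCont_setIntegral {g : Derivator} {T : ℝ} {f : ℝ → E}
    (hf : IntegrableOn f (Ico 0 T) g.measure) :
    g.AbsCont 0 T fun t => ∫ s in Ico 0 t, f s ∂g.measure := by
  intro ε hε
  obtain ⟨δ, hδ, h⟩ := exists_pos_setLIntegral_lt_of_measure_lt hf.2.ne
    (ε := ENNReal.ofReal ε) (ENNReal.ofReal_pos.2 hε).ne'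
  obtain ⟨r, hr, hrδ⟩ := ENNReal.lt_iff_exists_nnreal_btwn.1 hδ
  refine ⟨r, by simpa using hr, fun n u v huv hd hs => ?_⟩
  have hdisj : Pairwise (Function.onFun Disjoint fun i : Fin n => Ico (u i) (v i)) :=
    fun i j hij => disjoint_Ico_of_disjoint_Ioo (hd i j hij)
  have hsub : ∀ i, Ico (u i) (v i) ⊆ Ico 0 T := fun i => Ico_subset_Ico (huv i).1 (huv i).2.2
  have hdiff : ∀ i, (∫ s in Ico 0 (v i), f s ∂g.measure) - ∫ s in Ico 0 (u i), f s ∂g.measure =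
      ∫ s in Ico (u i) (v i), f s ∂g.measure := by
    intro i
    have e : Ico 0 (v i) = Ico 0 (u i) ∪ Ico (u i) (v i) :=
      (Ico_union_Ico_eq_Ico (huv i).1 (huv i).2.1.le).symm
    rw [e, setIntegral_union Ico_disjoint_Ico_same measurableSet_Ico
      (hf.mono_set (Ico_subset_Ico_right ((huv i).2.1.le.trans (huv i).2.2)))
      (hf.mono_set (hsub i)), add_sub_cancel_left]
  have hμ : g.measure.restrict (Ico 0 T) (⋃ i, Ico (u i) (v i)) < δ := by
    refine (Measure.restrict_apply_le _ _).trans_lt (lt_of_le_of_lt ?_ hrδ)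
    refine (measure_iUnion_le _).trans ?_
    rw [tsum_fintype]
    simp_rw [g.measure_Ico]
    rw [← ENNReal.ofReal_sum_of_nonneg fun i _ => sub_nonneg.2 (g.mono (huv i).2.1.le)]
    exact ENNReal.ofReal_le_of_le_toReal hs.le
  have hlt := h _ hμ
  rw [lintegral_iUnion (fun _ => measurableSet_Ico) hdisj, tsum_fintype] at hlt
  rw [← ENNReal.ofReal_lt_ofReal_iff hε, ENNReal.ofReal_sum_of_nonneg fun i _ => norm_nonneg _]
  refine lt_of_le_of_lt (Finset.sum_le_sum fun i _ => ?_) hlt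
  rw [hdiff, ofReal_norm, Measure.restrict_restrict measurableSet_Ico,
    inter_eq_left.2 (hsub i)]
  exact enorm_integral_le_lintegral_enorm _

/-- Lebesgue differentiation for the `g`-derivative. -/
theorem ae_hasGDerivAt_setIntegral [CompleteSpace E] {g : Derivator} {T : ℝ} (hT : 0 ≤ T)
    (hg0 : g 0 = 0) {f : ℝ → E} (hf : IntegrableOn f (Ico 0 T) g.measure) :
    ∀ᵐ t ∂(g.measure.restrict (Ico 0 T)),
      g.HasGDerivAt 0 T (fun t => ∫ s in Ico 0 t, f s ∂g.measure) (f t) t := by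
  have hinv := isGenInverse_rightInv hT hg0
  have hmap : ∀ t ∈ Icc 0 T, Measure.map (g.rightInv T) (volume.restrict (Ico 0 (g t))) =
      g.measure.restrict (Ico 0 t) := fun t ht =>
    hinv.map_eq hg0 (g.mono.monotoneOn _) (fun a b _ _ _ => g.measure_Ico a b) ht
  have hTT : T ∈ Icc 0 T := ⟨hT, le_rfl⟩
  -- The change of variables `y = g t` turns the integral into `Φ (g t)`, with `Φ` a Lebesgue
  -- primitive of `k`; the classical differentiation theorem then applies to `Φ`.
  set k : ℝ → E := (Ico 0 (g T)).indicator (f ∘ g.rightInv T) with hk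
  have hkint : Integrable k volume := by
    refine IntegrableOn.integrable_indicator ?_ measurableSet_Ico
    refine (integrable_map_measure ?_ (hinv.aemeasurable le_rfl)).1 ?_
    · rw [hmap T hTT]; exact hf.1
    · rw [hmap T hTT]; exact hf
  set Φ : ℝ → E := fun y => ∫ x in (0 : ℝ)..y, k x with hΦ
  have hΦc : Continuous Φ := intervalIntegral.continuous_primitive
    (fun a b => hkint.intervalIntegrable) 0
  have hF : ∀ t ∈ Icc 0 T, ∫ s in Ico 0 t, f s ∂g.measure = Φ (g t) := by
    intro t ht
    have hgt : 0 ≤ g t := hg0 ▸ g.mono ht.1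
    have hle : g t ≤ g T := g.mono ht.2
    have hae := hinv.aemeasurable hle
    rw [hΦ, ← hmap t ht, integral_map hae]
    · simp only
      rw [intervalIntegral.integral_of_le hgt, ← integral_Ico_eq_integral_Ioc]
      refine setIntegral_congr_fun measurableSet_Ico fun y hy => ?_
      rw [hk, indicator_of_mem (show y ∈ Ico 0 (g T) from ⟨hy.1, hy.2.trans_le hle⟩)]
      rfl
    · rw [hmap t ht]
      exact (hf.mono_set (Ico_subset_Ico_right ht.2)).1
  have hder : ∀ᵐ y, HasDerivAt Φ (k y) y := by
    filter_upwards [LocallyIntegrable.ae_hasDerivAt_integral hkint.locallyIntegrable] with y hy using hy 0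
  set Z : Set ℝ := toMeasurable volume {y | ¬ HasDerivAt Φ (k y) y} with hZ
  have hZ0 : volume Z = 0 := by rw [hZ, measure_toMeasurable]; exact hder
  have hZm : MeasurableSet Z := measurableSet_toMeasurable _ _
  have hgZ : ∀ᵐ t ∂(g.measure.restrict (Ico 0 T)), t ∉ g.jumpSet → g t ∉ Z := by
    rw [← hmap T hTT, ae_map_iff (hinv.aemeasurable le_rfl)]
    · rw [ae_restrict_iff' measurableSet_Ico]
      filter_upwards [measure_eq_zero_iff_ae_notMem.1 hZ0] with y hyZ hy hj
      suffices g (g.rightInv T y) = y by rwa [this]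
      -- Where `g` does not jump it inverts `rightInv` exactly, so the Lebesgue-null set `Z` pulls
      -- back to a `μ_g`-null set of non-jump points.
      refine le_antisymm (rightInv_mem hT hg0 hy.1).2 ?_
      have h1 := g.tendsto_nhdsGT (g.rightInv T y)
      rw [jump_eq_zero hj, add_zero] at h1
      exact ge_of_tendsto h1 (eventually_nhdsWithin_of_forall fun s hs =>
        (lt_of_rightInv_lt hT hg0 hy hs).le)
    · have : {t | t ∉ g.jumpSet → g t ∉ Z} = g.jumpSet ∪ (g ⁻¹' Z)ᶜ := by
        ext t; simp [imp_iff_not_or]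
      rw [this]
      exact g.measurableSet_jumpSet.union (g.mono.measurable hZm).compl
  filter_upwards [hgZ, ae_restrict_of_ae g.ae_mem_regularSet, ae_restrict_mem measurableSet_Ico]
    with t htZ hreg ht
  have htT : t ∈ Icc 0 T := ⟨ht.1, ht.2.le⟩
  have hgt : 0 ≤ g t := hg0 ▸ g.mono ht.1
  rw [hasGDerivAt_iff hreg ht]
  have hcongr : (fun s => (g s - g t)⁻¹ • (Φ (g s) - Φ (g t))) =ᶠ[g.approachFilter T t]
      fun s => (g s - g t)⁻¹ • ((∫ r in Ico 0 s, f r ∂g.measure) -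
        ∫ r in Ico 0 t, f r ∂g.measure) := by
    refine eventually_nhdsWithin_of_forall fun s hs => ?_
    simp only
    rw [hF s hs.2, hF t htT]
  refine Tendsto.congr' hcongr ?_
  have hg := g.tendsto_approachFilter T t
  by_cases hj : t ∈ g.jumpSet
  · have hpos : 0 < g.jump t := hj
    have h1 : Tendsto (fun s => (g s - g t)⁻¹ • (Φ (g s) - Φ (g t))) (g.approachFilter T t)
        (𝓝 ((g t + g.jump t - g t)⁻¹ • (Φ (g t + g.jump t) - Φ (g t)))) :=
      ((hg.sub_const _).inv₀ (by rw [add_sub_cancel_left]; exact hpos.ne')).smul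
        (((hΦc.tendsto _).comp hg).sub_const _)
    -- `rightInv` is constantly `t` on `[g t, g(t⁺))`, so `k` equals `f t` there.
    have h2 : Φ (g t + g.jump t) - Φ (g t) = g.jump t • f t := by
      rw [hΦ]
      simp only
      rw [intervalIntegral.integral_interval_sub_left hkint.intervalIntegrable
        hkint.intervalIntegrable, intervalIntegral.integral_of_le (by linarith),
        ← integral_Ico_eq_integral_Ioc, setIntegral_congr_fun (g := fun _ => f t) measurableSet_Ico]
      · simp [hpos.le]
      · intro y hy
        have h3 : g.rightInv T y = t := rightInv_eq hT hg0 htT hy.1 fun s hs =>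
          hy.2.trans_le (g.add_jump_le hs)
        rw [hk, indicator_of_mem (show y ∈ Ico 0 (g T) from
          ⟨hgt.trans hy.1, hy.2.trans_le (g.add_jump_le ht.2)⟩)]
        simp [h3]
    rwa [h2, add_sub_cancel_left, inv_smul_smul₀ hpos.ne'] at h1
  -- Off the jumps the `g`-quotient is an ordinary slope of `Φ` at `g t`.
  · have hd : HasDerivAt Φ (k (g t)) (g t) := by
      by_contra hc
      exact htZ hj (subset_toMeasurable _ _ hc)
    have hkt : k (g t) = f t := by
      rw [hk, indicator_of_mem (show g t ∈ Ico 0 (g T) from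
      ⟨hgt, lt_of_mem_regularSet hreg ht.2⟩), Function.comp_apply,
        rightInv_eq hT hg0 htT le_rfl fun s hs => lt_of_mem_regularSet hreg hs]
    rw [hkt, hasDerivAt_iff_tendsto_slope] at hd
    refine hd.comp (tendsto_nhdsWithin_iff.2 ⟨?_, ?_⟩)
    · rwa [jump_eq_zero hj, add_zero] at hg
    · filter_upwards [eventually_ne_approachFilter hreg] with s hs using sub_ne_zero.1 hs

end Derivator

/-! ### The `g`-exponential through a logarithmic density. -/

theorem Complex.norm_exp_sub_exp_le {C : ℝ} {x y : ℂ} (hx : ‖x‖ ≤ C) (hy : ‖y‖ ≤ C) :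
    ‖exp x - exp y‖ ≤ Real.exp C * ‖x - y‖ := by
  refine (convex_closedBall (0 : ℂ) C).norm_image_sub_le_of_norm_hasDerivWithin_le (f := exp)
    (f' := exp) (fun z _ => (hasDerivAt_exp z).hasDerivWithinAt) (fun z hz => ?_)
    (mem_closedBall_zero_iff.2 hy) (mem_closedBall_zero_iff.2 hx)
  rw [norm_exp]
  exact Real.exp_le_exp.2 ((re_le_norm z).trans (mem_closedBall_zero_iff.1 hz))

theorem Complex.continuous_dslope_exp : Continuous (dslope exp 0) := by
  rw [continuous_iff_continuousAt]
  intro x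
  rcases eq_or_ne x 0 with rfl | hx
  · exact continuousAt_dslope_same.2 differentiable_exp.differentiableAt
  · exact (continuousAt_dslope_of_ne hx).2 continuous_exp.continuousAt

theorem Complex.mul_dslope_exp (x : ℂ) : x * dslope exp 0 x = exp x - 1 := by
  simpa using sub_smul_dslope exp 0 x

namespace Derivator

/-- The density whose integral is the logarithm of the `g`-exponential of `β`. -/
noncomputable def expDensity (g : Derivator) (β : ℝ → ℂ) (t : ℝ) : ℂ :=
  if g.jump t = 0 then β t else Complex.log (1 + β t * g.jump t) / g.jump t

theorem exp_expDensity_mul_jump {g : Derivator} {β : ℝ → ℂ} {t : ℝ}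
    (h : 1 + β t * g.jump t ≠ 0) :
    Complex.exp (g.expDensity β t * g.jump t) = 1 + β t * g.jump t := by
  by_cases hj : g.jump t = 0
  · simp [hj]
  · have hj' : (g.jump t : ℂ) ≠ 0 := by exact_mod_cast hj
    rw [expDensity, if_neg hj, div_mul_cancel₀ _ hj', Complex.exp_log h]

/-- The density is chosen so that this holds: by the chain rule `tendsto_quotient_exp`, the left
side is the logarithmic `g`-derivative of `exp L`. -/
theorem expDensity_mul_dslope {g : Derivator} {β : ℝ → ℂ} {t : ℝ} (h : 1 + β t * g.jump t ≠ 0) :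
    g.expDensity β t * dslope Complex.exp 0 (g.jump t * g.expDensity β t) = β t := by
  by_cases hj : g.jump t = 0
  · simp [hj, expDensity, Complex.deriv_exp]
  · have hj' : (g.jump t : ℂ) ≠ 0 := by exact_mod_cast hj
    have h1 := Complex.mul_dslope_exp (g.jump t * g.expDensity β t)
    rw [mul_comm (g.jump t : ℂ), exp_expDensity_mul_jump h, mul_comm _ (g.jump t : ℂ)] at h1
    apply mul_left_cancel₀ hj'
    linear_combination h1

/-- The cancellation behind uniqueness. The factor `1 + β Δ⁺g` is the ratio of `v(t⁺)` to `v(t)`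
appearing in the product rule for `v exp (-L)`. -/
theorem neg_expDensity_mul_dslope {g : Derivator} {β : ℝ → ℂ} {t : ℝ}
    (h : 1 + β t * g.jump t ≠ 0) :
    -g.expDensity β t * dslope Complex.exp 0 (g.jump t * -g.expDensity β t) *
      (1 + β t * g.jump t) = -β t := by
  by_cases hj : g.jump t = 0
  · simp [hj, expDensity, Complex.deriv_exp]
  · have hj' : (g.jump t : ℂ) ≠ 0 := by exact_mod_cast hj
    have h1 := Complex.mul_dslope_exp (g.jump t * -g.expDensity β t)
    rw [show (g.jump t : ℂ) * -g.expDensity β t = -(g.expDensity β t * g.jump t) by ring,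
      Complex.exp_neg, exp_expDensity_mul_jump h] at h1
    rw [show (g.jump t : ℂ) * -g.expDensity β t = -(g.expDensity β t * g.jump t) by ring]
    apply mul_left_cancel₀ hj'
    have h2 : (1 + β t * g.jump t)⁻¹ * (1 + β t * g.jump t) = 1 := inv_mul_cancel₀ h
    linear_combination (1 + β t * g.jump t) * h1 + h2

/-- With `φ = dslope exp 0`, that is `φ x = (e^x - 1) / x` extended by `φ 0 = 1`, one has `e^{L s} -
e^{L t} = e^{L t} (L s - L t) φ (L s - L t)`. Continuity of `φ` handles jumps and continuity points
together. -/
theorem tendsto_quotient_exp {g : Derivator} {T t : ℝ} {L : ℝ → ℂ} {l : ℂ} (ht : t ∈ g.regularSet)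
    (hL : Tendsto (fun s => (g s - g t)⁻¹ • (L s - L t)) (g.approachFilter T t) (𝓝 l)) :
    Tendsto (fun s => (g s - g t)⁻¹ • (Complex.exp (L s) - Complex.exp (L t)))
      (g.approachFilter T t)
      (𝓝 (Complex.exp (L t) * (l * dslope Complex.exp 0 (g.jump t * l)))) := by
  have h1 := (tendsto_of_quotient ht hL).sub_const (L t)
  rw [add_sub_cancel_left, Complex.real_smul] at h1
  have h2 := (hL.mul ((Complex.continuous_dslope_exp.tendsto _).comp h1)).const_mul
    (Complex.exp (L t))
  refine h2.congr fun s => ?_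
  have h3 := Complex.mul_dslope_exp (L s - L t)
  rw [Complex.exp_sub] at h3
  simp only [Function.comp_apply, Complex.real_smul]
  have h4 : Complex.exp (L t) * (Complex.exp (L s) / Complex.exp (L t)) = Complex.exp (L s) :=
    mul_div_cancel₀ _ (Complex.exp_ne_zero _)
  linear_combination (((g s - g t)⁻¹ : ℝ) : ℂ) * (Complex.exp (L t) * h3 + h4)

/-- The usual product rule, except that `w'` is multiplied by the right limit of `v` when `t` is a
jump. -/
theorem tendsto_quotient_mul {g : Derivator} {T t : ℝ} {v w : ℝ → ℂ} {v' w' : ℂ}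
    (ht : t ∈ g.regularSet)
    (hv : Tendsto (fun s => (g s - g t)⁻¹ • (v s - v t)) (g.approachFilter T t) (𝓝 v'))
    (hw : Tendsto (fun s => (g s - g t)⁻¹ • (w s - w t)) (g.approachFilter T t) (𝓝 w')) :
    Tendsto (fun s => (g s - g t)⁻¹ • (v s * w s - v t * w t)) (g.approachFilter T t)
      (𝓝 (v' * w t + (v t + g.jump t * v') * w')) := by
  have h1 := tendsto_of_quotient ht hv
  rw [Complex.real_smul] at h1
  refine ((hv.mul_const (w t)).add (h1.mul hw)).congr fun s => ?_
  simp only [Complex.real_smul]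
  ring

theorem AbsCont.cexp {g : Derivator} {a b : ℝ} {L : ℝ → ℂ} (hL : g.AbsCont a b L) :
    g.AbsCont a b fun t => Complex.exp (L t) := by
  obtain ⟨C, hC, h⟩ := hL.exists_norm_le
  refine hL.of_norm_le hL (Real.exp_pos C) fun u v hu huv hv => ?_
  refine (Complex.norm_exp_sub_exp_le (h v ⟨hu.trans huv.le, hv⟩) (h u ⟨hu, huv.le.trans hv⟩)).trans
    (mul_le_mul_of_nonneg_left ?_ (Real.exp_pos C).le)
  linarith [norm_nonneg (L v - L u)]

theorem AbsCont.mul {g : Derivator} {a b : ℝ} {v w : ℝ → ℂ} (hv : g.AbsCont a b v)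
    (hw : g.AbsCont a b w) : g.AbsCont a b fun t => v t * w t := by
  obtain ⟨C, hC, h⟩ := hv.exists_norm_le
  obtain ⟨D, hD, h'⟩ := hw.exists_norm_le
  refine hv.of_norm_le hw (add_pos hC hD) fun x y hx hxy hy => ?_
  have e : v y * w y - v x * w x = (v y - v x) * w y + v x * (w y - w x) := by ring
  have h1 := h x ⟨hx, hxy.le.trans hy⟩
  have h2 := h' y ⟨hx.trans hxy.le, hy⟩
  rw [e]
  refine (norm_add_le _ _).trans ?_
  rw [norm_mul, norm_mul]
  have h3 := mul_le_mul_of_nonneg_left h2 (norm_nonneg (v y - v x))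
  have h4 := mul_le_mul_of_nonneg_right h1 (norm_nonneg (w y - w x))
  nlinarith [mul_nonneg hC.le (norm_nonneg (v y - v x)), mul_nonneg hD.le (norm_nonneg (w y - w x))]

section
variable {g : Derivator} {T : ℝ} {β : ℝ → ℂ}

theorem isExpSolution_iff {v : ℝ → ℂ} : g.IsExpSolution T β v ↔ g.AbsCont 0 T v ∧
    (∀ᵐ t ∂(g.measure.restrict (Ico 0 T)), g.HasGDerivAt 0 T v (β t * v t) t) ∧ v 0 = 1 :=
  Iff.rfl

theorem isExpSolution_cexp (hT : 0 ≤ T) (hg0 : g 0 = 0) (hβ : ∀ t, 1 + β t * g.jump t ≠ 0)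
    (hint : IntegrableOn (g.expDensity β) (Ico 0 T) g.measure) :
    g.IsExpSolution T β
      fun t => Complex.exp (∫ s in Ico 0 t, g.expDensity β s ∂g.measure) := by
  refine isExpSolution_iff.2 ⟨(absCont_setIntegral hint).cexp, ?_, by simp⟩
  filter_upwards [ae_hasGDerivAt_setIntegral hT hg0 hint, ae_restrict_of_ae g.ae_mem_regularSet,
    ae_restrict_mem measurableSet_Ico] with t hd hreg ht
  rw [hasGDerivAt_iff hreg ht] at hd ⊢
  have h := tendsto_quotient_exp hreg hd
  rwa [expDensity_mul_dslope (hβ t), mul_comm] at h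

theorem IsExpSolution.eqOn_cexp (hT : 0 ≤ T) (hg0 : g 0 = 0) (hβ : ∀ t, 1 + β t * g.jump t ≠ 0)
    (hint : IntegrableOn (g.expDensity β) (Ico 0 T) g.measure) {v : ℝ → ℂ}
    (hv : g.IsExpSolution T β v) :
    EqOn v (fun t => Complex.exp (∫ s in Ico 0 t, g.expDensity β s ∂g.measure)) (Icc 0 T) := by
  obtain ⟨hAC, hvd, hv0⟩ := isExpSolution_iff.1 hv
  set L : ℝ → ℂ := fun t => ∫ s in Ico 0 t, g.expDensity β s ∂g.measure with hL
  have hLAC : g.AbsCont 0 T L := absCont_setIntegral hint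
  have hnegAC : g.AbsCont 0 T fun t => -L t :=
    hLAC.of_norm_le hLAC one_pos fun x y _ _ _ => by
      rw [← neg_sub', norm_neg, one_mul]
      linarith [norm_nonneg (L y - L x)]
  -- `v exp (-L)` is constant, with value `1` at `0`.
  have hconst := (hAC.mul hnegAC.cexp).eq_of_hasGDerivAt_zero (by
    filter_upwards [ae_hasGDerivAt_setIntegral hT hg0 hint, hvd,
      ae_restrict_of_ae g.ae_mem_regularSet, ae_restrict_mem measurableSet_Ico]
      with t hLd hvd hreg ht
    rw [hasGDerivAt_iff hreg ht] at hLd hvd ⊢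
    have hneg : Tendsto (fun s => (g s - g t)⁻¹ • (-L s - -L t)) (g.approachFilter T t)
        (𝓝 (-g.expDensity β t)) := hLd.neg.congr fun s => by
      rw [← smul_neg]; congr 1; ring
    have h := tendsto_quotient_mul hreg hvd (tendsto_quotient_exp hreg hneg)
    have h0 := neg_expDensity_mul_dslope (hβ t)
    convert h using 2
    linear_combination (-v t * Complex.exp (-L t)) * h0)
  intro t ht
  have h1 := hconst t ht
  have hL0 : L 0 = 0 := by simp [hL]
  rw [hv0, hL0, neg_zero, Complex.exp_zero, mul_one, Complex.exp_neg] at h1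
  exact (mul_inv_eq_one₀ (Complex.exp_ne_zero _)).1 h1

end

end Derivator

/-! ### The logarithm of `1 + i x` and integrability of the density. -/

theorem Real.abs_arctan_le_abs (x : ℝ) : |arctan x| ≤ |x| := by
  have h : ∀ y : ℝ, 0 ≤ y → arctan y ≤ y := fun y hy => by
    simpa [tan_arctan] using le_tan (arctan_nonneg.2 hy) (arctan_lt_pi_div_two y)
  rcases le_total 0 x with hx | hx
  · rw [abs_of_nonneg hx, abs_of_nonneg (arctan_nonneg.2 hx)]
    exact h x hx
  · rw [abs_of_nonpos hx, abs_of_nonpos (arctan_le_zero.2 hx), ← arctan_neg]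
    exact h (-x) (by linarith)

namespace Complex

theorem one_add_ofReal_mul_I_ne_zero (x : ℝ) : 1 + (x : ℂ) * I ≠ 0 := fun h => by
  simpa using congrArg re h

theorem norm_one_add_ofReal_mul_I (x : ℝ) : ‖1 + (x : ℂ) * I‖ = √(1 + x ^ 2) := by
  rw [norm_def, normSq_apply]
  congr 1
  simp
  ring

theorem arg_one_add_ofReal_mul_I (x : ℝ) : arg (1 + (x : ℂ) * I) = Real.arctan x := by
  rw [arg_of_re_nonneg (by simp), norm_one_add_ofReal_mul_I, Real.arctan_eq_arcsin]
  simp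

/-- One `|x|` bounds the real part, from `0 ≤ log r ≤ r - 1` with `1 ≤ r = ‖1 + i x‖ ≤ 1 + |x|`; the
other bounds the argument `arctan x`. -/
theorem norm_log_one_add_ofReal_mul_I_le (x : ℝ) : ‖log (1 + (x : ℂ) * I)‖ ≤ 2 * |x| := by
  have h1 : 1 ≤ ‖1 + (x : ℂ) * I‖ := by simpa using re_le_norm (1 + (x : ℂ) * I)
  have h2 : ‖1 + (x : ℂ) * I‖ ≤ 1 + |x| := by
    simpa using norm_add_le (1 : ℂ) ((x : ℂ) * I)
  have h3 := Real.log_le_sub_one_of_pos (zero_lt_one.trans_le h1)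
  have h4 := Real.log_nonneg h1
  have h5 := norm_le_abs_re_add_abs_im (log (1 + (x : ℂ) * I))
  rw [log_re, log_im, arg_one_add_ofReal_mul_I, abs_of_nonneg h4] at h5
  linarith [Real.abs_arctan_le_abs x]

end Complex

namespace Derivator

section density
variable {g : Derivator} {T : ℝ} {b : ℝ → ℝ}

theorem one_add_mul_I_mul_jump (g : Derivator) (b : ℝ → ℝ) (t : ℝ) :
    1 + (b t : ℂ) * Complex.I * (g.jump t : ℂ) = 1 + ((b t * g.jump t : ℝ) : ℂ) * Complex.I := by
  push_cast; ring

theorem one_add_mul_I_mul_jump_ne_zero (g : Derivator) (b : ℝ → ℝ) (t : ℝ) :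
    1 + (b t : ℂ) * Complex.I * (g.jump t : ℂ) ≠ 0 := by
  rw [one_add_mul_I_mul_jump]
  exact Complex.one_add_ofReal_mul_I_ne_zero _

theorem norm_expDensity_le (g : Derivator) (b : ℝ → ℝ) (t : ℝ) :
    ‖g.expDensity (fun s => (b s : ℂ) * Complex.I) t‖ ≤ 2 * ‖b t‖ := by
  rw [expDensity]
  split_ifs with hj
  · simp
    linarith [abs_nonneg (b t)]
  · have hpos : 0 < g.jump t := lt_of_le_of_ne (g.jump_nonneg t) (Ne.symm hj)
    have h := Complex.norm_log_one_add_ofReal_mul_I_le (b t * g.jump t)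
    rw [one_add_mul_I_mul_jump, norm_div, Complex.norm_real, Real.norm_of_nonneg hpos.le,
      div_le_iff₀ hpos, Real.norm_eq_abs]
    rwa [abs_mul, abs_of_pos hpos, ← mul_assoc] at h

theorem measurable_expDensity (g : Derivator) {β : ℝ → ℂ} (hβ : Measurable β) :
    Measurable (g.expDensity β) := by
  refine Measurable.ite (g.measurable_jump (measurableSet_singleton 0)) hβ ?_
  have := g.measurable_jump
  fun_prop

theorem integrableOn_expDensity (hb : IntegrableOn b (Ico 0 T) g.measure) :
    IntegrableOn (g.expDensity fun s => (b s : ℂ) * Complex.I) (Ico 0 T) g.measure := by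
  refine Integrable.mono (hb.const_mul 2) ?_ (ae_of_all _ fun t => ?_)
  -- `b` is only almost everywhere measurable, so the density is built from a Borel representative.
  · obtain ⟨b', hb', hbb'⟩ := hb.1.aemeasurable
    have hm : Measurable (g.expDensity fun s => (b' s : ℂ) * Complex.I) :=
      g.measurable_expDensity (by fun_prop)
    refine (hm.aemeasurable.congr ?_).aestronglyMeasurable
    filter_upwards [hbb'] with t ht
    simp only [expDensity, ht]
  · rw [norm_mul]
    simpa using g.norm_expDensity_le b t

end density

/-! ### The atomic and continuous parts of `μ_g`. -/

theorem hasSum_setIntegral_inter_jumpSet {E : Type*} [NormedAddCommGroup E] [NormedSpace ℝ E]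
    [CompleteSpace E] {g : Derivator} {s : Set ℝ} {f : ℝ → E} (hf : IntegrableOn f s g.measure) :
    HasSum (fun u : ↥(s ∩ g.jumpSet) => g.jump u • f u)
      (∫ r in s ∩ g.jumpSet, f r ∂g.measure) := by
  have : Countable ↥(s ∩ g.jumpSet) := (g.countable_jumpSet.mono inter_subset_right).to_subtype
  have hU : ⋃ u : ↥(s ∩ g.jumpSet), {(u : ℝ)} = s ∩ g.jumpSet := by
    ext x; simp
  have h := hasSum_integral_iUnion (μ := g.measure) (f := f)
    (s := fun u : ↥(s ∩ g.jumpSet) => {(u : ℝ)}) (fun u => measurableSet_singleton _)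
    (fun u v huv => disjoint_singleton.2 fun h => huv (Subtype.ext h))
    (by rw [hU]; exact hf.mono_set inter_subset_left)
  rw [hU] at h
  convert h using 2 with u
  rw [integral_singleton, Measure.real, g.measure_singleton,
    ENNReal.toReal_ofReal (g.jump_nonneg _)]

section contPart
variable {g : Derivator} {T : ℝ}

/-- The jump part is the mass of the atoms in `[0, t)`, so removing it leaves the mass off `D_g`.
Monotonicity and the increments of `g^C` follow from this description. -/
theorem contPart_eq (hg0 : g 0 = 0) {t : ℝ} (ht : 0 ≤ t) :
    g.contPart 0 t = g.measure.real (Ico 0 t \ g.jumpSet) := by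
  have hfin := (g.measure_Ico_lt_top 0 t).ne
  have h1 : g.jumpPart 0 t = g.measure.real (Ico 0 t ∩ g.jumpSet) := by
    rcases ht.eq_or_lt with rfl | ht'
    -- At `t = 0` the definition takes its `else` branch, an empty sum.
    · have : IsEmpty ↥(Ico (0 : ℝ) 0 ∩ g.jumpSet) := by simp
      rw [jumpPart, if_neg (lt_irrefl 0), tsum_empty]
      simp
    · have h := hasSum_setIntegral_inter_jumpSet (g := g) (s := Ico 0 t) (f := fun _ => (1 : ℝ))
        (integrableOn_const hfin)
      rw [jumpPart, if_pos ht']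
      simpa using h.tsum_eq
  have h2 : g.measure.real (Ico 0 t) = g t := by
    rw [Measure.real, g.measure_Ico, hg0, sub_zero,
      ENNReal.toReal_ofReal (hg0 ▸ g.mono ht)]
  rw [contPart, h1, ← h2, ← measureReal_inter_add_sdiff g.measurableSet_jumpSet hfin]
  ring

theorem measure_Ico_sdiff_jumpSet (hg0 : g 0 = 0) {s t : ℝ} (hs : 0 ≤ s) (hst : s ≤ t) :
    g.measure.real (Ico s t \ g.jumpSet) = g.contPart 0 t - g.contPart 0 s := by
  have hsub : Ico 0 t \ g.jumpSet = (Ico 0 s \ g.jumpSet) ∪ (Ico s t \ g.jumpSet) := by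
    rw [← union_sdiff_distrib, Ico_union_Ico_eq_Ico hs hst]
  have hd : Disjoint (Ico 0 s \ g.jumpSet) (Ico s t \ g.jumpSet) :=
    Ico_disjoint_Ico_same.mono sdiff_subset sdiff_subset
  rw [contPart_eq hg0 (hs.trans hst), contPart_eq hg0 hs, hsub,
    measureReal_union hd (measurableSet_Ico.diff g.measurableSet_jumpSet)
      (measure_ne_top_of_subset sdiff_subset (g.measure_Ico_lt_top 0 s).ne)
      (measure_ne_top_of_subset sdiff_subset (g.measure_Ico_lt_top s t).ne)]
  ring

end contPart

section contPart
variable {g : Derivator} {T : ℝ}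

theorem contPart_zero (hg0 : g 0 = 0) : g.contPart 0 0 = 0 := by
  simp [contPart_eq hg0 le_rfl]

theorem contPart_monotoneOn (hg0 : g 0 = 0) : MonotoneOn (g.contPart 0) (Icc 0 T) := by
  intro s hs t _ hst
  have h := measure_Ico_sdiff_jumpSet hg0 hs.1 hst
  linarith [measureReal_nonneg (μ := g.measure) (s := Ico s t \ g.jumpSet)]

/-- Discarding the atom at `s` makes the bound tend to `0` as `t → s⁺`, which gives right-continuity
of `g^C`; left-continuity comes from that of `g`. -/
theorem contPart_sub_le (hg0 : g 0 = 0) {s t : ℝ} (hs : 0 ≤ s) (hst : s < t) :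
    g.contPart 0 t - g.contPart 0 s ≤ g t - g s - g.jump s := by
  have hfin := (g.measure_Ico_lt_top s t).ne
  have hI : g.measure.real (Ico s t) = g t - g s := by
    rw [Measure.real, g.measure_Ico, ENNReal.toReal_ofReal (sub_nonneg.2 (g.mono hst.le))]
  rw [← measure_Ico_sdiff_jumpSet hg0 hs hst.le, ← hI]
  by_cases hj : s ∈ g.jumpSet
  · have h1 : g.measure.real {s} = g.jump s := by
      rw [Measure.real, g.measure_singleton, ENNReal.toReal_ofReal (g.jump_nonneg s)]
    have hd : Disjoint (Ico s t \ g.jumpSet) {s} := disjoint_singleton_right.2 fun h => h.2 hj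
    rw [le_sub_iff_add_le, ← h1, ← measureReal_union hd (measurableSet_singleton s)
      (measure_ne_top_of_subset sdiff_subset hfin)
      (measure_ne_top_of_subset (singleton_subset_iff.2 (left_mem_Ico.2 hst)) hfin)]
    exact measureReal_mono (union_subset sdiff_subset (singleton_subset_iff.2 (left_mem_Ico.2 hst))) hfin
  · rw [jump_eq_zero hj, sub_zero]
    exact measureReal_mono sdiff_subset hfin

theorem contPart_continuousOn (hg0 : g 0 = 0) : ContinuousOn (g.contPart 0) (Icc 0 T) := by
  intro t ht
  have hmono := contPart_monotoneOn (g := g) (T := T) hg0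
  have hl : ContinuousWithinAt (g.contPart 0) (Icc 0 T ∩ Iio t) t := by
    have h1 : Tendsto (fun s => g.contPart 0 t - (g t - g s)) (𝓝[Icc 0 T ∩ Iio t] t)
        (𝓝 (g.contPart 0 t)) := by
      have := (((g.leftCts t).mono (inter_subset_right.trans Iio_subset_Iic_self) :
        ContinuousWithinAt g (Icc 0 T ∩ Iio t) t).const_sub (g t)).const_sub (g.contPart 0 t)
      simpa using this
    refine tendsto_of_tendsto_of_tendsto_of_le_of_le' h1 tendsto_const_nhds ?_ ?_
    · refine eventually_nhdsWithin_of_forall fun s hs => ?_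
      linarith [contPart_sub_le hg0 hs.1.1 hs.2, g.jump_nonneg s]
    · exact eventually_nhdsWithin_of_forall fun s hs => hmono hs.1 ht (le_of_lt hs.2)
  have hr : ContinuousWithinAt (g.contPart 0) (Icc 0 T ∩ Ioi t) t := by
    have h1 : Tendsto (fun s => g.contPart 0 t + (g s - g t - g.jump t)) (𝓝[Icc 0 T ∩ Ioi t] t)
        (𝓝 (g.contPart 0 t)) := by
      have := ((((g.tendsto_nhdsGT t).mono_left (nhdsWithin_mono t
        (inter_subset_right (s := Icc 0 T)))).sub_const (g t)).sub_const (g.jump t)).const_add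
        (g.contPart 0 t)
      simpa using this
    refine tendsto_of_tendsto_of_tendsto_of_le_of_le' tendsto_const_nhds h1 ?_ ?_
    · exact eventually_nhdsWithin_of_forall fun s hs => hmono ht hs.1 (le_of_lt hs.2)
    · refine eventually_nhdsWithin_of_forall fun s hs => ?_
      linarith [contPart_sub_le hg0 ht.1 hs.2]
  refine (continuousWithinAt_insert_self.2 (hl.union hr)).mono fun s hs => ?_
  rcases lt_trichotomy s t with h | h | h
  · exact Or.inr (Or.inl ⟨hs, h⟩)
  · exact Or.inl h
  · exact Or.inr (Or.inr ⟨hs, h⟩)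

/-- Continuity of `g^C` provides a preimage of each value, by the intermediate value theorem, and
makes each level set closed, so the infimum is a minimum. -/
theorem isGenInverse_pseudoInv (hT : 0 ≤ T) (hg0 : g 0 = 0) :
    IsGenInverse T (g.contPart 0) (g.pseudoInv 0 T) := by
  have hcont := contPart_continuousOn (g := g) (T := T) hg0
  have hmono := contPart_monotoneOn (g := g) (T := T) hg0
  have hbdd : ∀ y, BddBelow {t | t ∈ Icc 0 T ∧ g.contPart 0 t = y} := fun y =>
    ⟨0, fun t ht => ht.1.1⟩
  have hivt : ∀ s ∈ Icc 0 T, ∀ y ∈ Icc 0 (g.contPart 0 s),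
      ∃ r ∈ Icc 0 s, g.contPart 0 r = y := by
    intro s hs y hy
    refine intermediate_value_Icc hs.1 (hcont.mono (Icc_subset_Icc_right hs.2)) ?_
    rwa [contPart_zero hg0]
  have hmem : ∀ y ∈ Ico 0 (g.contPart 0 T),
      g.pseudoInv 0 T y ∈ {t | t ∈ Icc 0 T ∧ g.contPart 0 t = y} := by
    intro y hy
    obtain ⟨r, hr, hry⟩ := hivt T ⟨hT, le_rfl⟩ y ⟨hy.1, hy.2.le⟩
    exact IsClosed.csInf_mem (hcont.preimage_isClosed_of_isClosed isClosed_Icc isClosed_singleton)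
      ⟨r, hr, hry⟩ (hbdd y)
  refine ⟨fun y hy => (hmem y hy).1, fun y hy s hs h => ?_, fun y hy s hs h => ?_⟩
  · obtain ⟨r, hr, hry⟩ := hivt s hs y ⟨hy.1, h.le⟩
    refine (csInf_le (hbdd y) ⟨⟨hr.1, hr.2.trans hs.2⟩, hry⟩).trans_lt (lt_of_le_of_ne hr.2 ?_)
    rintro rfl
    exact h.ne' hry
  · have h1 := hmem y hy
    rw [← h1.2]
    exact hmono h1.1 hs h.le

theorem map_pseudoInv (hg0 : g 0 = 0) {t : ℝ} (ht : t ∈ Icc 0 T) :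
    Measure.map (g.pseudoInv 0 T) (volume.restrict (Ico 0 (g.contPart 0 t))) =
      g.measure.restrict (Ico 0 t \ g.jumpSet) := by
  rw [(isGenInverse_pseudoInv (ht.1.trans ht.2) hg0).map_eq (contPart_zero hg0)
    (contPart_monotoneOn hg0) (ν := g.measure.restrict g.jumpSetᶜ) _ ht,
    Measure.restrict_restrict measurableSet_Ico, sdiff_eq]
  intro a b ha hab _
  rw [Measure.restrict_apply measurableSet_Ico, ← sdiff_eq, ← measure_Ico_sdiff_jumpSet hg0 ha hab,
    ofReal_measureReal (measure_ne_top_of_subset sdiff_subset (g.measure_Ico_lt_top a b).ne)]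

theorem integrableOn_comp_pseudoInv (hg0 : g 0 = 0) {t : ℝ} (ht : t ∈ Icc 0 T) {b : ℝ → ℝ}
    (hb : IntegrableOn b (Ico 0 t) g.measure) :
    IntegrableOn (fun x => b (g.pseudoInv 0 T x)) (Ico 0 (g.contPart 0 t)) volume ∧
      ∫ x in Ico 0 (g.contPart 0 t), b (g.pseudoInv 0 T x) =
        ∫ s in Ico 0 t \ g.jumpSet, b s ∂g.measure := by
  have hb' := hb.mono_set (sdiff_subset (t := g.jumpSet))
  have hae := (isGenInverse_pseudoInv (ht.1.trans ht.2) hg0).aemeasurable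
    (contPart_monotoneOn hg0 ht ⟨ht.1.trans ht.2, le_rfl⟩ ht.2)
  rw [IntegrableOn, ← map_pseudoInv hg0 ht] at hb'
  refine ⟨(integrable_map_measure hb'.1 hae).1 hb', ?_⟩
  rw [← map_pseudoInv hg0 ht, integral_map hae hb'.1]

end contPart

/-! ### The explicit form of `exp_g(± ib; 0, ·)`. -/

section exp
variable {g : Derivator} {T : ℝ} {b : ℝ → ℝ}

theorem hasSum_log (hb : IntegrableOn b (Ico 0 T) g.measure) :
    HasSum (fun u : ↥(Ico 0 T ∩ g.jumpSet) =>
        Complex.log (1 + (b u : ℂ) * Complex.I * (g.jump u : ℂ)))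
      (∫ r in Ico 0 T ∩ g.jumpSet, g.expDensity (fun s => (b s : ℂ) * Complex.I) r ∂g.measure) := by
  refine HasSum.congr_fun (hasSum_setIntegral_inter_jumpSet (integrableOn_expDensity hb)) ?_
  intro u
  have hj : g.jump u ≠ 0 := (show 0 < g.jump u from u.2.2).ne'
  have hj' : (g.jump u : ℂ) ≠ 0 := by exact_mod_cast hj
  rw [expDensity, if_neg hj, Complex.real_smul, mul_div_cancel₀ _ hj']

theorem setIntegral_expDensity (hg0 : g 0 = 0) {t : ℝ} (ht : t ∈ Icc 0 T)
    (hb : IntegrableOn b (Ico 0 t) g.measure) :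
    ∫ r in Ico 0 t, g.expDensity (fun s => (b s : ℂ) * Complex.I) r ∂g.measure =
      (∫ r in Ico 0 t ∩ g.jumpSet, g.expDensity (fun s => (b s : ℂ) * Complex.I) r ∂g.measure) +
        (∫ x in Ico 0 (g.contPart 0 t), b (g.pseudoInv 0 T x) : ℝ) * Complex.I := by
  rw [← integral_inter_add_sdiff g.measurableSet_jumpSet (integrableOn_expDensity hb),
    (integrableOn_comp_pseudoInv hg0 ht hb).2]
  congr 1
  rw [← integral_complex_ofReal, ← integral_mul_const]
  refine setIntegral_congr_fun (measurableSet_Ico.diff g.measurableSet_jumpSet) fun s hs => ?_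
  simp [expDensity, jump_eq_zero hs.2]

theorem isExpSolution_gExp (hT : 0 ≤ T) (hg0 : g 0 = 0)
    (hb : IntegrableOn b (Ico 0 T) g.measure) :
    g.IsExpSolution T (fun s => (b s : ℂ) * Complex.I)
      (g.gExp T fun s => (b s : ℂ) * Complex.I) :=
  Classical.epsilon_spec ⟨_, isExpSolution_cexp hT hg0 (g.one_add_mul_I_mul_jump_ne_zero b)
    (integrableOn_expDensity hb)⟩

theorem IsExpSolution.eqOn {v w : ℝ → ℂ} (hT : 0 ≤ T) (hg0 : g 0 = 0)
    (hb : IntegrableOn b (Ico 0 T) g.measure)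
    (hv : g.IsExpSolution T (fun s => (b s : ℂ) * Complex.I) v)
    (hw : g.IsExpSolution T (fun s => (b s : ℂ) * Complex.I) w) : EqOn v w (Icc 0 T) :=
  have hβ := g.one_add_mul_I_mul_jump_ne_zero b
  (hv.eqOn_cexp hT hg0 hβ (integrableOn_expDensity hb)).trans
    (hw.eqOn_cexp hT hg0 hβ (integrableOn_expDensity hb)).symm

theorem IsExpSolution.conj {v : ℝ → ℂ}
    (hv : g.IsExpSolution T (fun s => (b s : ℂ) * Complex.I) v) :
    g.IsExpSolution T (fun s => -(b s : ℂ) * Complex.I) fun t => starRingEnd ℂ (v t) := by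
  obtain ⟨h1, h2, h3⟩ := isExpSolution_iff.1 hv
  refine isExpSolution_iff.2 ⟨h1.clm_comp (Complex.conjCLE : ℂ →L[ℝ] ℂ), ?_, by simp [h3]⟩
  filter_upwards [h2] with t ht
  have h : -(b t : ℂ) * Complex.I * starRingEnd ℂ (v t) =
      starRingEnd ℂ ((b t : ℂ) * Complex.I * v t) := by simp
  rw [h]
  exact ht.clm_comp (Complex.conjCLE : ℂ →L[ℝ] ℂ)

/-- As `b` is real, conjugating the solution for `ib` solves the problem for `-ib`. Uniqueness
identifies the two only on `[0, T]`, since solutions are unconstrained elsewhere. -/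
theorem gExp_neg_eq_conj (hT : 0 ≤ T) (hg0 : g 0 = 0)
    (hb : IntegrableOn b (Ico 0 T) g.measure) :
    EqOn (g.gExp T fun s => -(b s : ℂ) * Complex.I)
      (fun t => starRingEnd ℂ (g.gExp T (fun s => (b s : ℂ) * Complex.I) t)) (Icc 0 T) := by
  have e : (fun s => -(b s : ℂ) * Complex.I) = fun s => ((-b) s : ℂ) * Complex.I := by
    funext s; simp
  have h := (isExpSolution_gExp hT hg0 hb).conj
  rw [e] at h ⊢
  exact (isExpSolution_gExp hT hg0 hb.neg).eqOn hT hg0 hb.neg h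

theorem norm_one_add_pos (g : Derivator) (b : ℝ → ℝ) (t : ℝ) :
    0 < ‖1 + (b t : ℂ) * Complex.I * (g.jump t : ℂ)‖ :=
  norm_pos_iff.2 (g.one_add_mul_I_mul_jump_ne_zero b t)

theorem hasSum_log_norm (hb : IntegrableOn b (Ico 0 T) g.measure) :
    HasSum (fun u : ↥(Ico 0 T ∩ g.jumpSet) =>
        Real.log ‖1 + (b u : ℂ) * Complex.I * (g.jump u : ℂ)‖)
      (∫ r in Ico 0 T ∩ g.jumpSet,
        g.expDensity (fun s => (b s : ℂ) * Complex.I) r ∂g.measure).re := by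
  simpa only [Complex.log_re] using Complex.hasSum_re (hasSum_log hb)

theorem hasProd_norm (hb : IntegrableOn b (Ico 0 T) g.measure) :
    HasProd (fun u : ↥(Ico 0 T ∩ g.jumpSet) =>
        ‖1 + (b u : ℂ) * Complex.I * (g.jump u : ℂ)‖)
      (Real.exp (∫ r in Ico 0 T ∩ g.jumpSet,
        g.expDensity (fun s => (b s : ℂ) * Complex.I) r ∂g.measure).re) :=
  Real.hasProd_of_hasSum_log (fun u => g.norm_one_add_pos b u) (hasSum_log_norm hb)

theorem hasSum_arctan (hb : IntegrableOn b (Ico 0 T) g.measure) :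
    HasSum (fun u : ↥(Ico 0 T ∩ g.jumpSet) => Real.arctan (b u * g.jump u))
      (∫ r in Ico 0 T ∩ g.jumpSet,
        g.expDensity (fun s => (b s : ℂ) * Complex.I) r ∂g.measure).im := by
  simpa only [Complex.log_im, one_add_mul_I_mul_jump, Complex.arg_one_add_ofReal_mul_I] using
    Complex.hasSum_im (hasSum_log hb)

/-- Polar form: the real part of the exponent comes only from the jumps and gives the modulus, while
the continuous part contributes a pure phase. -/
theorem gExp_eq (hT : 0 ≤ T) (hg0 : g 0 = 0) (hb : IntegrableOn b (Ico 0 T) g.measure) {t : ℝ}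
    (ht : t ∈ Icc 0 T) :
    g.gExp T (fun s => (b s : ℂ) * Complex.I) t =
      (∏' u : ↥(Ico 0 t ∩ g.jumpSet), ‖1 + (b u : ℂ) * Complex.I * (g.jump u : ℂ)‖ : ℝ) *
        Complex.exp (((∑' u : ↥(Ico 0 t ∩ g.jumpSet), Real.arctan (b u * g.jump u)) +
          ∫ x in Ico 0 (g.contPart 0 t), b (g.pseudoInv 0 T x) : ℝ) * Complex.I) := by
  have hbt := hb.mono_set (Ico_subset_Ico_right ht.2)
  refine ((isExpSolution_gExp hT hg0 hb).eqOn_cexp hT hg0 (g.one_add_mul_I_mul_jump_ne_zero b)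
    (integrableOn_expDensity hb) ht).trans ?_
  simp only
  rw [(hasProd_norm hbt).tprod_eq, (hasSum_arctan hbt).tsum_eq,
    setIntegral_expDensity hg0 ht hbt, Complex.ofReal_exp, ← Complex.exp_add]
  congr 1
  conv_lhs => rw [← Complex.re_add_im (∫ r in Ico 0 t ∩ g.jumpSet, _ ∂g.measure)]
  push_cast
  ring

end exp

/-! ### The `g`-sine and `g`-cosine as imaginary and real parts. -/

section sinCos
variable {g : Derivator} {T : ℝ} {b : ℝ → ℝ}

/-- The real-linear map `(x, y) ↦ y + i x`. -/
noncomputable def sinCosToExp : (Fin 2 → ℝ) →L[ℝ] ℂ :=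
  (ContinuousLinearMap.proj 1).smulRight (1 : ℂ) + (ContinuousLinearMap.proj 0).smulRight Complex.I

/-- The real-linear map `z ↦ (Im z, Re z)`. -/
noncomputable def expToSinCos : ℂ →L[ℝ] (Fin 2 → ℝ) :=
  ContinuousLinearMap.pi ![Complex.imCLM, Complex.reCLM]

theorem sinCosToExp_apply (X : Fin 2 → ℝ) :
    sinCosToExp X = (X 1 : ℂ) + (X 0 : ℂ) * Complex.I := by
  simp [sinCosToExp]

theorem expToSinCos_apply (z : ℂ) : expToSinCos z = ![z.im, z.re] := by
  ext i; fin_cases i <;> simp [expToSinCos]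

theorem expToSinCos_sinCosToExp (X : Fin 2 → ℝ) : expToSinCos (sinCosToExp X) = X := by
  rw [expToSinCos_apply, sinCosToExp_apply]
  ext i; fin_cases i <;> simp

theorem isSinCosSolution_iff {X : ℝ → Fin 2 → ℝ} : g.IsSinCosSolution T b X ↔
    g.AbsCont 0 T X ∧ (∀ᵐ t ∂(g.measure.restrict (Ico 0 T)),
      g.HasGDerivAt 0 T X (Matrix.mulVec !![0, b t; -b t, 0] (X t)) t) ∧ X 0 = ![0, 1] :=
  Iff.rfl

/-- `(y + i x)' = -b x + i b y = i b (y + i x)`, and bounded linear maps preserve both `g`-absolute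
continuity and `g`-derivatives. -/
theorem IsSinCosSolution.isExpSolution {X : ℝ → Fin 2 → ℝ} (hX : g.IsSinCosSolution T b X) :
    g.IsExpSolution T (fun s => (b s : ℂ) * Complex.I) fun t => sinCosToExp (X t) := by
  obtain ⟨h1, h2, h3⟩ := isSinCosSolution_iff.1 hX
  refine isExpSolution_iff.2 ⟨h1.clm_comp _, ?_, by simp [h3, sinCosToExp_apply]⟩
  filter_upwards [h2] with t ht
  convert ht.clm_comp sinCosToExp using 1
  rw [sinCosToExp_apply, sinCosToExp_apply]
  simp [Matrix.mulVec, dotProduct, Fin.sum_univ_two]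
  linear_combination (b t * X t 0 : ℂ) * Complex.I_sq

theorem IsExpSolution.isSinCosSolution {v : ℝ → ℂ}
    (hv : g.IsExpSolution T (fun s => (b s : ℂ) * Complex.I) v) :
    g.IsSinCosSolution T b fun t => expToSinCos (v t) := by
  obtain ⟨h1, h2, h3⟩ := isExpSolution_iff.1 hv
  refine isSinCosSolution_iff.2 ⟨h1.clm_comp _, ?_, by simp [h3, expToSinCos_apply]⟩
  filter_upwards [h2] with t ht
  convert ht.clm_comp expToSinCos using 1
  rw [expToSinCos_apply, expToSinCos_apply]
  ext i
  fin_cases i <;> simp [Matrix.mulVec, dotProduct, Fin.sum_univ_two]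

theorem isSinCosSolution_gSinCos (hT : 0 ≤ T) (hg0 : g 0 = 0)
    (hb : IntegrableOn b (Ico 0 T) g.measure) : g.IsSinCosSolution T b (g.gSinCos T b) :=
  Classical.epsilon_spec ⟨_, (isExpSolution_gExp hT hg0 hb).isSinCosSolution⟩

theorem IsSinCosSolution.eqOn (hT : 0 ≤ T) (hg0 : g 0 = 0)
    (hb : IntegrableOn b (Ico 0 T) g.measure) {X : ℝ → Fin 2 → ℝ}
    (hX : g.IsSinCosSolution T b X) :
    EqOn X (fun t => expToSinCos (g.gExp T (fun s => (b s : ℂ) * Complex.I) t)) (Icc 0 T) := by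
  intro t ht
  have h := hX.isExpSolution.eqOn hT hg0 hb (isExpSolution_gExp hT hg0 hb) ht
  simp only [← h, expToSinCos_sinCosToExp]

theorem gSin_eq (hT : 0 ≤ T) (hg0 : g 0 = 0) (hb : IntegrableOn b (Ico 0 T) g.measure) {t : ℝ}
    (ht : t ∈ Icc 0 T) : g.gSin T b t = (g.gExp T (fun s => (b s : ℂ) * Complex.I) t).im := by
  rw [gSin, (isSinCosSolution_gSinCos hT hg0 hb).eqOn hT hg0 hb ht]
  simp [expToSinCos_apply]

theorem gCos_eq (hT : 0 ≤ T) (hg0 : g 0 = 0) (hb : IntegrableOn b (Ico 0 T) g.measure) {t : ℝ}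
    (ht : t ∈ Icc 0 T) : g.gCos T b t = (g.gExp T (fun s => (b s : ℂ) * Complex.I) t).re := by
  rw [gCos, (isSinCosSolution_gSinCos hT hg0 hb).eqOn hT hg0 hb ht]
  simp [expToSinCos_apply]

end sinCos

end Derivator

theorem mainTheorem8 (g : Derivator) (T : ℝ) (hT : 0 < T)
    (hg0 : g 0 = 0) (hgc : ContinuousAt g 0)
    (b : ℝ → ℝ) (hb : IntegrableOn b (Ico 0 T) g.measure) :
    -- the linear problems that define the functions are uniquely solvable on `[0, T]`
    (g.IsSinCosSolution T b (g.gSinCos T b) ∧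
      ∀ X, g.IsSinCosSolution T b X → EqOn X (g.gSinCos T b) (Icc 0 T)) ∧
    (g.IsExpSolution T (fun s => (b s : ℂ) * Complex.I)
        (g.gExp T (fun s => (b s : ℂ) * Complex.I)) ∧
      ∀ v, g.IsExpSolution T (fun s => (b s : ℂ) * Complex.I) v →
        EqOn v (g.gExp T (fun s => (b s : ℂ) * Complex.I)) (Icc 0 T)) ∧
    (g.IsExpSolution T (fun s => -(b s : ℂ) * Complex.I)
        (g.gExp T (fun s => -(b s : ℂ) * Complex.I)) ∧
      ∀ v, g.IsExpSolution T (fun s => -(b s : ℂ) * Complex.I) v →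
        EqOn v (g.gExp T (fun s => -(b s : ℂ) * Complex.I)) (Icc 0 T)) ∧
    ∀ t ∈ Icc 0 T,
      -- expressions through the complex `g`-exponential
      ((g.gSin T b t : ℝ) : ℂ) =
        (g.gExp T (fun s => (b s : ℂ) * Complex.I) t -
          g.gExp T (fun s => -(b s : ℂ) * Complex.I) t) / (2 * Complex.I) ∧
      ((g.gCos T b t : ℝ) : ℂ) =
        (g.gExp T (fun s => (b s : ℂ) * Complex.I) t +
          g.gExp T (fun s => -(b s : ℂ) * Complex.I) t) / 2 ∧
      -- the product, the sum and the integral below converge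
      Multipliable (fun u : ↥(Ico 0 t ∩ g.jumpSet) =>
        ‖1 + (b u : ℂ) * Complex.I * (g.jump u : ℂ)‖) ∧
      Summable (fun u : ↥(Ico 0 t ∩ g.jumpSet) => Real.arctan (b u * g.jump u)) ∧
      IntegrableOn (fun x => b (g.pseudoInv 0 T x)) (Ico 0 (g.contPart 0 t)) volume ∧
      -- explicit expressions
      g.gSin T b t =
        (∏' u : ↥(Ico 0 t ∩ g.jumpSet), ‖1 + (b u : ℂ) * Complex.I * (g.jump u : ℂ)‖) *
            Real.sin (∑' u : ↥(Ico 0 t ∩ g.jumpSet), Real.arctan (b u * g.jump u)) *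
            Real.cos (∫ x in Ico 0 (g.contPart 0 t), b (g.pseudoInv 0 T x)) +
          (∏' u : ↥(Ico 0 t ∩ g.jumpSet), ‖1 + (b u : ℂ) * Complex.I * (g.jump u : ℂ)‖) *
            Real.cos (∑' u : ↥(Ico 0 t ∩ g.jumpSet), Real.arctan (b u * g.jump u)) *
            Real.sin (∫ x in Ico 0 (g.contPart 0 t), b (g.pseudoInv 0 T x)) ∧
      g.gCos T b t =
        (∏' u : ↥(Ico 0 t ∩ g.jumpSet), ‖1 + (b u : ℂ) * Complex.I * (g.jump u : ℂ)‖) *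
            Real.cos (∑' u : ↥(Ico 0 t ∩ g.jumpSet), Real.arctan (b u * g.jump u)) *
            Real.cos (∫ x in Ico 0 (g.contPart 0 t), b (g.pseudoInv 0 T x)) -
          (∏' u : ↥(Ico 0 t ∩ g.jumpSet), ‖1 + (b u : ℂ) * Complex.I * (g.jump u : ℂ)‖) *
            Real.sin (∑' u : ↥(Ico 0 t ∩ g.jumpSet), Real.arctan (b u * g.jump u)) *
            Real.sin (∫ x in Ico 0 (g.contPart 0 t), b (g.pseudoInv 0 T x)) := by
  -- The problem for `-ib` is the problem for `ib` with `b` replaced by `-b`.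
  have hneg : (fun s => -(b s : ℂ) * Complex.I) = fun s => ((-b) s : ℂ) * Complex.I := by
    funext s; simp
  have hexp := Derivator.isExpSolution_gExp hT.le hg0 hb
  have hexpn := Derivator.isExpSolution_gExp hT.le hg0 hb.neg
  have hsc := Derivator.isSinCosSolution_gSinCos hT.le hg0 hb
  refine ⟨⟨hsc, fun X hX => (hX.eqOn hT.le hg0 hb).trans (hsc.eqOn hT.le hg0 hb).symm⟩,
    ⟨hexp, fun v hv => hv.eqOn hT.le hg0 hb hexp⟩, ?_, fun t ht => ?_⟩
  · rw [hneg]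
    exact ⟨hexpn, fun v hv => hv.eqOn hT.le hg0 hb.neg hexpn⟩
  have hbt := hb.mono_set (Ico_subset_Ico_right ht.2)
  have hE := Derivator.gExp_eq hT.le hg0 hb ht
  have hconj := Derivator.gExp_neg_eq_conj hT.le hg0 hb ht
  refine ⟨?_, ?_, (Derivator.hasProd_norm hbt).multipliable,
    (Derivator.hasSum_arctan hbt).summable,
    (Derivator.integrableOn_comp_pseudoInv hg0 ht hbt).1, ?_, ?_⟩
  · rw [Derivator.gSin_eq hT.le hg0 hb ht, hconj, Complex.im_eq_sub_conj]
  · rw [Derivator.gCos_eq hT.le hg0 hb ht, hconj, Complex.re_eq_add_conj]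
  · rw [Derivator.gSin_eq hT.le hg0 hb ht, hE, Complex.im_ofReal_mul,
      Complex.exp_ofReal_mul_I_im, Real.sin_add]
    ring
  · rw [Derivator.gCos_eq hT.le hg0 hb ht, hE, Complex.re_ofReal_mul,
      Complex.exp_ofReal_mul_I_re, Real.cos_add]
    ring
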